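/- Let $a,b>0$ be real with $a\neq b$. For $\lambda\in\mathbb{C}\setminus\{-a^2,-b^2\}$ let $\mathcal{C}_\lambda\subset\mathbb{CP}^2$ be the conic $\frac{x^2}{a^2+\lambda}+\frac{y^2}{b^2+\lambda}=z^2$, let $\mathcal{E}=\mathcal{C}_0$ be the complexified ellipse, and let $\gamma^3_1=\mathcal{C}_{\lambda_-}$, $\gamma^3_2=\mathcal{C}_{\lambda_+}$ be the two triangular caustics, where $$\lambda_\pm=\frac{a^2b^2(a^2+b^2)\pm 2a^2b^2\sqrt{a^4-a^2b^2+b^4}}{(a^2-b^2)^2}.$$ A line of $\mathbb{CP}^2$ is isotropic if it contains $(1:i:0)$ or $(1:-i:0)$. The symmetry with respect to a non-isotropic line $L$ is (the projective extension of) the unique non-trivial affine involution of $\mathbb{C}^2$ that is isometric for $q(x,y)=x^2+y^2$ and fixes the points of $L$. A non-degenerate triangular orbit is an ordered triple $(M_0,M_1,M_2)$ of points of $\mathcal{E}$ (indices modulo $3$) such that for all $j$: $M_j\neq M_{j+1}$, the tangent line $T_{M_j}\mathcal{E}$ is non-isotropic, and the symmetry with respect to $T_{M_j}\mathcal{E}$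 maps the line $M_{j-1}M_j$ to the line $M_jM_{j+1}$. A degenerate triangular orbit is an ordered triple of points of $\mathcal{E}$ which is a limit of non-degenerate triangular orbits but is not a non-degenerate triangular orbit. An isotropic tangency point of $\mathcal{E}$ is a point of $\mathcal{E}$ at which the tangent line of $\mathcal{E}$ is isotropic. Then, up to the order of the vertices (that is, counted as unordered triples with multiplicity), there are exactly $8$ degenerate triangular orbits. More precisely, an ordered triple is a degenerate triangular orbit if and only if it is $(\alpha,\alpha,\beta)$, $(\alpha,\beta,\alpha)$ or $(\beta,\alpha,\alpha)$ for an isotropic tangency point $\alpha$ of $\mathcal{E}$ and a point $\beta\in\mathcal{E}$, $\beta\neq\alpha$, such that the line $\alpha\beta$ is non-isotropic and tangent to $\gamma^3_1$ or $\gamma^3_2$. For each isotropic tangency point $\alpha$ and each $j\in\{1,2\}$ there is exactly one such $\beta$ for which $\alpha\beta$ is tangent to $\gamma^3_j$. -/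

import Mathlib

open scoped LinearAlgebra.Projectivization

noncomputable section

/-- The complex projective plane. A vector `X : Fin 3 → ℂ` is a triple `(x : y : z)` of homogeneous
coordinates; the affine chart is `z ≠ 0` and the line at infinity is `z = 0`. -/
abbrev CP2 : Type := ℙ ℂ (Fin 3 → ℂ)

/-- The usual topology of the complex projective plane: the quotient topology from `ℂ³ ∖ {0}`. -/
instance instTopologicalSpaceCP2 : TopologicalSpace CP2 :=
  TopologicalSpace.coinduced
    (Projectivization.mk' ℂ : {v : Fin 3 → ℂ // v ≠ 0} → CP2) inferInstance

/-! Projective lines are represented by the corresponding planes (two-dimensional linear subspaces)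
of `ℂ³`. -/

/-- The projective line `PQ` through two (distinct) points `P`, `Q`. -/
def lineThrough (P Q : CP2) : Submodule ℂ (Fin 3 → ℂ) := P.submodule ⊔ Q.submodule

/-- A projective line is isotropic if it passes through one of the cyclic points
`I = (1 : i : 0)`, `J = (1 : -i : 0)`. -/
def IsIsotropic (L : Submodule ℂ (Fin 3 → ℂ)) : Prop :=
  ![1, Complex.I, 0] ∈ L ∨ ![1, -Complex.I, 0] ∈ L

/-- The bilinear form
`(X, X') ↦ x x' / (a² + lam) + y y' / (b² + lam) - z z'` defining the conic `C_lam`. -/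
def conicForm (a b : ℝ) (lam : ℂ) : LinearMap.BilinForm ℂ (Fin 3 → ℂ) :=
  Matrix.toBilin'
    (Matrix.diagonal ![1 / ((a : ℂ) ^ 2 + lam), 1 / ((b : ℂ) ^ 2 + lam), -1])

/-- The confocal conic `C_lam : x² / (a² + lam) + y² / (b² + lam) = z²` in the projective plane
(for `lam ≠ -a², -b²`). -/
def conic (a b : ℝ) (lam : ℂ) : Set CP2 :=
  {P | conicForm a b lam P.rep P.rep = 0}

/-- The tangent line of `C_lam` at the point `P` of `C_lam`, i.e. the set of all `X` which are
orthogonal to `P` for the form defining `C_lam`. -/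
def tangentLine (a b : ℝ) (lam : ℂ) (P : CP2) : Submodule ℂ (Fin 3 → ℂ) :=
  (conicForm a b lam).orthogonal P.submodule

/-- The line `L` is tangent to the conic `C_lam`. -/
def IsTangentToConic (a b : ℝ) (lam : ℂ) (L : Submodule ℂ (Fin 3 → ℂ)) : Prop :=
  ∃ P ∈ conic a b lam, L = tangentLine a b lam P

/-- The complexified ellipse `E = C_0`. -/
def ellipse (a b : ℝ) : Set CP2 := conic a b 0

/-- The tangent line of `E` at `P`. -/
def ellipseTangent (a b : ℝ) (P : CP2) : Submodule ℂ (Fin 3 → ℂ) := tangentLine a b 0 P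

/-- `σ` is the projective extension (written in homogeneous coordinates) of a non-trivial involution
of `ℂ²` that is affine, isometric for `q(x, y) = x² + y²`, and fixes all points of the line `L`.
If `L` is non-isotropic there is exactly one such `σ`, the symmetry with respect to `L`.
The field `affine` says that `σ` is the homogenization of an affine map of the chart `z = 1`, and
`isometric` says that the linear part of this affine map preserves `q`. -/
structure IsSymmetry (L : Submodule ℂ (Fin 3 → ℂ))
    (σ : (Fin 3 → ℂ) →ₗ[ℂ] (Fin 3 → ℂ)) : Prop where
  affine : ∀ X, σ X 2 = X 2
  isometric : ∀ X, X 2 = 0 → σ X 0 ^ 2 + σ X 1 ^ 2 = X 0 ^ 2 + X 1 ^ 2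
  involutive : ∀ X, σ (σ X) = X
  nontrivial : σ ≠ LinearMap.id
  fixes : ∀ X ∈ L, σ X = X

/-- The lines `l` and `l'` are symmetric with respect to the (non-isotropic) line `L`. -/
def AreSymmetric (L l l' : Submodule ℂ (Fin 3 → ℂ)) : Prop :=
  ∃ σ, IsSymmetry L σ ∧ l.map σ = l'

/-- `(M 0, M 1, M 2)` is a non-degenerate triangular orbit of the complex billiard in `E`
(indices are cyclic: arithmetic in `Fin 3` is modulo `3`). -/
structure IsTriangularOrbit (a b : ℝ) (M : Fin 3 → CP2) : Prop where
  mem : ∀ j, M j ∈ ellipse a b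
  ne : ∀ j, M j ≠ M (j + 1)
  nonisotropic : ∀ j, ¬ IsIsotropic (ellipseTangent a b (M j))
  reflection : ∀ j, AreSymmetric (ellipseTangent a b (M j))
    (lineThrough (M (j - 1)) (M j)) (lineThrough (M j) (M (j + 1)))

/-- `(M 0, M 1, M 2)` is a degenerate triangular orbit: an ordered triple of points of `E` which is
the limit of non-degenerate triangular orbits but is not such an orbit itself. -/
structure IsDegenerateTriangularOrbit (a b : ℝ) (M : Fin 3 → CP2) : Prop where
  mem : ∀ j, M j ∈ ellipse a b
  isLimit : ∃ u : ℕ → Fin 3 → CP2, (∀ k, IsTriangularOrbit a b (u k)) ∧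
    Filter.Tendsto u Filter.atTop (nhds M)
  not_orbit : ¬ IsTriangularOrbit a b M

/-- `P` is an isotropic tangency point of `E`: the tangency point of an isotropic tangent line. -/
def IsIsotropicTangencyPoint (a b : ℝ) (P : CP2) : Prop :=
  P ∈ ellipse a b ∧ IsIsotropic (ellipseTangent a b P)

/-- The parameters `λ₋` (for `j = 0`) and `λ₊` (for `j = 1`) of the two triangular caustics. -/
def causticParam (a b : ℝ) : Fin 2 → ℝ :=
  ![(a ^ 2 * b ^ 2 * (a ^ 2 + b ^ 2) - 2 * a ^ 2 * b ^ 2 * √(a ^ 4 - a ^ 2 * b ^ 2 + b ^ 4))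
      / (a ^ 2 - b ^ 2) ^ 2,
    (a ^ 2 * b ^ 2 * (a ^ 2 + b ^ 2) + 2 * a ^ 2 * b ^ 2 * √(a ^ 4 - a ^ 2 * b ^ 2 + b ^ 4))
      / (a ^ 2 - b ^ 2) ^ 2]

/-- `L` is tangent to the triangular caustic `γ_j`, the conic `C_lam` with
`lam = causticParam a b j`. -/
def IsTangentToCaustic (a b : ℝ) (j : Fin 2) (L : Submodule ℂ (Fin 3 → ℂ)) : Prop :=
  IsTangentToConic a b (causticParam a b j : ℂ) L

/-- `α` is an isotropic tangency point of `E` and `β` is another point of `E` such that the line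
`αβ` is non-isotropic and tangent to the triangular caustic `γ_j`. -/
structure IsDegeneratePair (a b : ℝ) (j : Fin 2) (α β : CP2) : Prop where
  tangency : IsIsotropicTangencyPoint a b α
  mem : β ∈ ellipse a b
  ne : α ≠ β
  nonisotropic : ¬ IsIsotropic (lineThrough α β)
  tangent : IsTangentToCaustic a b j (lineThrough α β)

end

/-! Parametrize `E` by `t = x.1 / x.2` in the projective line, so that `t = e^{iθ}` gives the usual
`(a cos θ, b sin θ)`, and put `k = (a - b) / (a + b)`. The tangent line at `t` is isotropic exactly
when `t² = k` or `k t² = 1`, which gives four points.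

For fixed elementary symmetric functions of three parameters, the reflection law at one of them is a
cubic equation in that parameter, and it is the same cubic for all three (`reflForm_eq`). For
distinct vertices this cubic must be a multiple of the one with the three parameters as roots.
Comparing coefficients shows that the parameters form a fibre of `t ↦ t (t² + m) / (m t² + 1)`,
where `k m² = (1 + k²) m + 3 k` (`exists_inFibre`). The two roots `m` are rescalings of `λ₋` and
`λ₊` (`fibreParam_root`). Conversely, every fibre with three distinct points is a triangular orbit
(`isTriangularOrbit_of_inFibre`).

For both values of `m` the critical points of the degree three map are the four isotropic tangency
parameters (`InFibre.pairDet_mul_eq_zero_iff`). By compactness limits of orbits are fibres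
(`exists_inFibre_of_tendsto`), so a degenerate orbit is a critical fibre: a double point `s` at an
isotropic tangency point and a third point `(m - s²) / (2 s)`. Each critical fibre is a limit of
fibres with distinct points (`exists_fibres_tendsto`).

Confocal conics have the same isotropic tangents. Hence one of the two tangents to `γ_j` from an
isotropic tangency point is the isotropic tangent of `E` itself; the other meets `E` again in the
third point of the critical fibre (`chord_thirdPoint_iff`). Four points and two caustics give `8`
orbits. -/

/-! ### Binary forms: the reflection law and the fibres of the cubic map. -/

/-- The determinant of two vectors of `ℂ²`; it vanishes iff they span the same line. -/
def pairDet (x y : ℂ × ℂ) : ℂ := x.1 * y.2 - y.1 * x.2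

/-- The polynomial condition expressing that the chords `t x` and `t y` of the ellipse are symmetric
with respect to the tangent line at `t`. -/
def reflForm (k : ℂ) (t x y : ℂ × ℂ) : ℂ :=
  t.1 * t.2 * ((1 + k ^ 2) * t.2 ^ 2 - 2 * k * t.1 ^ 2) * (x.1 * y.1)
    - k * (t.2 ^ 4 - t.1 ^ 4) * (x.1 * y.2 + y.1 * x.2)
    + t.1 * t.2 * (2 * k * t.2 ^ 2 - (1 + k ^ 2) * t.1 ^ 2) * (x.2 * y.2)

/-- `x, y, z` are the three points of a fibre of the degree three map
`t ↦ t (t² + m) / (m t² + 1)` of the projective line, counted with multiplicity. -/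
def InFibre (m : ℂ) (x y z : ℂ × ℂ) : Prop :=
  x.1 * y.2 * z.2 + y.1 * x.2 * z.2 + z.1 * x.2 * y.2 = m * (x.1 * y.1 * z.1) ∧
  x.1 * y.1 * z.2 + x.1 * z.1 * y.2 + y.1 * z.1 * x.2 = m * (x.2 * y.2 * z.2)

lemma InFibre.swap₁₂ {m : ℂ} {x y z : ℂ × ℂ} (h : InFibre m x y z) : InFibre m y x z :=
  ⟨by linear_combination h.1, by linear_combination h.2⟩

lemma InFibre.rotate {m : ℂ} {x y z : ℂ × ℂ} (h : InFibre m x y z) : InFibre m y z x :=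
  ⟨by linear_combination h.1, by linear_combination h.2⟩

lemma InFibre.smul {m : ℂ} {x y z : ℂ × ℂ} (h : InFibre m x y z) (c d e : ℂ) :
    InFibre m (c • x) (d • y) (e • z) := by
  constructor
  · simp only [Prod.smul_fst, Prod.smul_snd, smul_eq_mul]
    linear_combination c * d * e * h.1
  · simp only [Prod.smul_fst, Prod.smul_snd, smul_eq_mul]
    linear_combination c * d * e * h.2

lemma pairDet_eq_zero_iff {x y : ℂ × ℂ} (hx : x ≠ 0) (hy : y ≠ 0) :
    pairDet x y = 0 ↔ ∃ c : ℂ, c ≠ 0 ∧ y = c • x := by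
  obtain ⟨x1, x2⟩ := x
  obtain ⟨y1, y2⟩ := y
  simp only [ne_eq, Prod.mk_eq_zero, not_and_or, pairDet, Prod.smul_mk, smul_eq_mul,
    Prod.mk.injEq] at *
  constructor
  · intro h
    by_cases h1 : x1 = 0
    · have h2 : x2 ≠ 0 := by tauto
      have hy1 : y1 = 0 := by
        subst h1
        simpa [h2] using h
      refine ⟨y2 / x2, div_ne_zero (by tauto) h2, by simp [h1, hy1], by field_simp⟩
    · refine ⟨y1 / x1, div_ne_zero ?_ h1, by field_simp, ?_⟩
      · rintro rfl
        have : y2 = 0 := by simpa [h1] using h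
        tauto
      · field_simp
        linear_combination h
  · rintro ⟨c, -, rfl, rfl⟩
    ring

/-- Division of the binary cubic in `T, U` by the linear form `x.2 T - x.1 U`; the `qᵢ` are the
coefficients of the quotient. -/
lemma exists_cubic_factor {c0 c1 c2 c3 : ℂ} {x : ℂ × ℂ} (hx : x ≠ 0)
    (h : c0 * x.1 ^ 3 + c1 * x.1 ^ 2 * x.2 + c2 * x.1 * x.2 ^ 2 + c3 * x.2 ^ 3 = 0) :
    ∃ q0 q1 q2, c0 = x.2 * q0 ∧ c1 = x.2 * q1 - x.1 * q0 ∧ c2 = x.2 * q2 - x.1 * q1 ∧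
      c3 = -x.1 * q2 := by
  obtain ⟨u, v⟩ := x
  simp only [ne_eq, Prod.mk_eq_zero, not_and_or] at *
  by_cases hv : v = 0
  · have hu : u ≠ 0 := by tauto
    subst hv
    have h0 : c0 = 0 := by simpa [hu] using h
    exact ⟨-c1 / u, -c2 / u, -c3 / u, by simp [h0], by field_simp; ring, by field_simp; ring,
      by field_simp⟩
  · refine ⟨c0 / v, (c1 + u * c0 / v) / v, (c2 + u * ((c1 + u * c0 / v) / v)) / v,
      by field_simp, by field_simp; ring, by field_simp; ring, ?_⟩
    field_simp
    linear_combination h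

lemma exists_quadratic_factor {c0 c1 c2 : ℂ} {x : ℂ × ℂ} (hx : x ≠ 0)
    (h : c0 * x.1 ^ 2 + c1 * x.1 * x.2 + c2 * x.2 ^ 2 = 0) :
    ∃ q0 q1, c0 = x.2 * q0 ∧ c1 = x.2 * q1 - x.1 * q0 ∧ c2 = -x.1 * q1 := by
  -- Multiplying the quadratic by the second variable makes it a cubic with leading coefficient `0`;
  -- if `x.2 ≠ 0`, the quotient has leading coefficient `0` as well.
  obtain ⟨q0, q1, q2, h0, h1, h2, h3⟩ := exists_cubic_factor (c0 := 0) (c1 := c0) (c2 := c1)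
    (c3 := c2) hx (by linear_combination x.2 * h)
  obtain ⟨u, v⟩ := x
  simp only [ne_eq, Prod.mk_eq_zero, not_and_or] at *
  by_cases hv : v = 0
  · have hu : u ≠ 0 := by tauto
    subst hv
    have h0 : c0 = 0 := by simpa [hu] using h
    exact ⟨-c1 / u, -c2 / u, by simp [h0], by field_simp; ring, by field_simp⟩
  · have hq : q0 = 0 := by simpa [hv] using h0.symm
    subst hq
    exact ⟨q1, q2, by simpa using h1, h2, h3⟩

lemma exists_linear_factor {c0 c1 : ℂ} {x : ℂ × ℂ} (hx : x ≠ 0)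
    (h : c0 * x.1 + c1 * x.2 = 0) : ∃ q, c0 = x.2 * q ∧ c1 = -x.1 * q := by
  obtain ⟨u, v⟩ := x
  simp only [ne_eq, Prod.mk_eq_zero, not_and_or] at *
  by_cases hv : v = 0
  · have hu : u ≠ 0 := by tauto
    subst hv
    have h0 : c0 = 0 := by simpa [hu] using h
    exact ⟨-c1 / u, by simp [h0], by field_simp⟩
  · refine ⟨c0 / v, by field_simp, ?_⟩
    field_simp
    linear_combination h

/-- A binary cubic form with three given distinct roots is determined up to a factor. -/
lemma cubic_eq_of_roots {c0 c1 c2 c3 : ℂ} {x y z : ℂ × ℂ} (hx : x ≠ 0) (hy : y ≠ 0) (hz : z ≠ 0)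
    (hxy : pairDet x y ≠ 0) (hxz : pairDet x z ≠ 0) (hyz : pairDet y z ≠ 0)
    (h : ∀ t ∈ ({x, y, z} : Set (ℂ × ℂ)),
      c0 * t.1 ^ 3 + c1 * t.1 ^ 2 * t.2 + c2 * t.1 * t.2 ^ 2 + c3 * t.2 ^ 3 = 0) :
    ∃ c, c0 = c * (x.2 * y.2 * z.2) ∧
      c1 = -c * (x.1 * y.2 * z.2 + y.1 * x.2 * z.2 + z.1 * x.2 * y.2) ∧
      c2 = c * (x.1 * y.1 * z.2 + x.1 * z.1 * y.2 + y.1 * z.1 * x.2) ∧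
      c3 = -c * (x.1 * y.1 * z.1) := by
  obtain ⟨q0, q1, q2, rfl, rfl, rfl, rfl⟩ := exists_cubic_factor hx (h x (by simp))
  have hq : ∀ t ∈ ({y, z} : Set (ℂ × ℂ)), pairDet x t ≠ 0 →
      q0 * t.1 ^ 2 + q1 * t.1 * t.2 + q2 * t.2 ^ 2 = 0 := by
    intro t ht hd
    have := h t (Set.mem_insert_of_mem _ ht)
    refine (mul_eq_zero.1 (?_ : pairDet x t * _ = 0)).resolve_left hd
    rw [pairDet]
    linear_combination -this
  obtain ⟨r0, r1, rfl, rfl, rfl⟩ := exists_quadratic_factor hy (hq y (by simp) hxy)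
  obtain ⟨c, rfl, rfl⟩ : ∃ q, r0 = z.2 * q ∧ r1 = -z.1 * q := by
    refine exists_linear_factor hz ?_
    refine (mul_eq_zero.1 (?_ : pairDet y z * _ = 0)).resolve_left hyz
    rw [pairDet]
    linear_combination -(hq z (by simp) hxz)
  exact ⟨c, by ring, by ring, by ring, by ring⟩

/-- The coefficients on the right are symmetric in the three points, so the three reflection laws
say that one and the same cubic vanishes at `x`, `y` and `z`. -/
lemma reflForm_eq (k : ℂ) (x y z : ℂ × ℂ) {E0 E1 E2 E3 : ℂ} (h0 : E0 = x.2 * y.2 * z.2)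
    (h1 : E1 = x.1 * y.2 * z.2 + y.1 * x.2 * z.2 + z.1 * x.2 * y.2)
    (h2 : E2 = x.1 * y.1 * z.2 + x.1 * z.1 * y.2 + y.1 * z.1 * x.2)
    (h3 : E3 = x.1 * y.1 * z.1) :
    reflForm k x y z = (k * E2 - (1 + k ^ 2) * E0) * x.1 ^ 3 + (-3 * k * E3) * x.1 ^ 2 * x.2
      + (3 * k * E0) * x.1 * x.2 ^ 2 + ((1 + k ^ 2) * E3 - k * E1) * x.2 ^ 3 := by
  subst h0 h1 h2 h3
  rw [reflForm]
  ring

/-- A triple of distinct points which satisfies the three reflection laws is a fibre. -/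
lemma exists_inFibre {k : ℂ} (hk : k ≠ 0) {x y z : ℂ × ℂ} (hx : x ≠ 0) (hy : y ≠ 0) (hz : z ≠ 0)
    (hxy : pairDet x y ≠ 0) (hxz : pairDet x z ≠ 0) (hyz : pairDet y z ≠ 0)
    (h1 : reflForm k x y z = 0) (h2 : reflForm k y z x = 0) (h3 : reflForm k z x y = 0) :
    ∃ m, k * m ^ 2 = (1 + k ^ 2) * m + 3 * k ∧ InFibre m x y z := by
  obtain ⟨E0, h0e⟩ : ∃ E, E = x.2 * y.2 * z.2 := ⟨_, rfl⟩
  obtain ⟨E1, h1e⟩ : ∃ E, E = x.1 * y.2 * z.2 + y.1 * x.2 * z.2 + z.1 * x.2 * y.2 := ⟨_, rfl⟩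
  obtain ⟨E2, h2e⟩ : ∃ E, E = x.1 * y.1 * z.2 + x.1 * z.1 * y.2 + y.1 * z.1 * x.2 := ⟨_, rfl⟩
  obtain ⟨E3, h3e⟩ : ∃ E, E = x.1 * y.1 * z.1 := ⟨_, rfl⟩
  rw [reflForm_eq k x y z h0e h1e h2e h3e] at h1
  rw [reflForm_eq k y z x (h0e.trans (by ring)) (h1e.trans (by ring)) (h2e.trans (by ring))
    (h3e.trans (by ring))] at h2
  rw [reflForm_eq k z x y (h0e.trans (by ring)) (h1e.trans (by ring)) (h2e.trans (by ring))
    (h3e.trans (by ring))] at h3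
  obtain ⟨c, g0, g1, g2, g3⟩ := cubic_eq_of_roots hx hy hz hxy hxz hyz (by
    rintro t (rfl | rfl | rfl)
    exacts [h1, h2, h3])
  rw [← h0e] at g0
  rw [← h1e] at g1
  rw [← h2e] at g2
  rw [← h3e] at g3
  -- Otherwise all four coefficients of a product of three nonzero linear forms would vanish.
  have hne : ¬ (E0 = 0 ∧ E3 = 0) := by
    rintro ⟨z0, z3⟩
    have z2 : E2 = 0 := by
      have : k * E2 = 0 := by linear_combination g0 + (1 + k ^ 2 + c) * z0
      simpa [hk] using this
    have z1 : E1 = 0 := by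
      have : k * E1 = 0 := by linear_combination -g3 + (1 + k ^ 2 + c) * z3
      simpa [hk] using this
    have key : ∀ t : ℂ × ℂ, pairDet x t * pairDet y t * pairDet z t = 0 := by
      intro t
      have : pairDet x t * pairDet y t * pairDet z t
          = -E0 * t.1 ^ 3 + E1 * t.1 ^ 2 * t.2 - E2 * t.1 * t.2 ^ 2 + E3 * t.2 ^ 3 := by
        subst h0e h1e h2e h3e
        simp only [pairDet]
        ring
      rw [this, z0, z1, z2, z3]
      ring
    have ex : ∀ w : ℂ × ℂ, w ≠ 0 → (w.1 ≠ 0 ∨ w.2 ≠ 0) := by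
      intro w hw
      by_contra hcon
      push Not at hcon
      exact hw (Prod.ext hcon.1 hcon.2)
    rw [h0e] at z0
    rw [h3e] at z3
    simp only [mul_eq_zero] at z0 z3
    have hx' := ex x hx
    have hy' := ex y hy
    have hz' := ex z hz
    subst h0e h1e h2e h3e
    simp only [pairDet] at hxy hxz hyz
    rcases z0 with (z0 | z0) | z0 <;> rcases z3 with (z3 | z3) | z3 <;>
      simp_all
  have hc : c ≠ 0 := by
    rintro rfl
    exact hne ⟨by simpa [hk] using g2, by simpa [hk] using g1⟩
  -- The middle coefficients read `3 k E3 = c E1` and `3 k E0 = c E2`, whence `m = 3 k / c`. The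
  -- outer ones give the quadratic equation for `m`.
  refine ⟨3 * k / c, ?_, ?_⟩
  · have a1 : (k * (3 * k) - (1 + k ^ 2) * c - c * c) * E0 = 0 := by
      linear_combination c * g0 + k * g2
    have a2 : (k * (3 * k) - (1 + k ^ 2) * c - c * c) * E3 = 0 := by
      linear_combination -c * g3 - k * g1
    have : k * (3 * k) - (1 + k ^ 2) * c - c * c = 0 := by
      by_contra hcon
      exact hne ⟨by simpa [hcon] using a1, by simpa [hcon] using a2⟩
    field_simp
    linear_combination this
  · refine ⟨?_, ?_⟩
    · rw [← h1e, ← h3e]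
      field_simp
      linear_combination g1
    · rw [← h2e, ← h0e]
      field_simp
      linear_combination -g2

lemma param_ne_zero {k m : ℂ} (hk : k ≠ 0) (hm : k * m ^ 2 = (1 + k ^ 2) * m + 3 * k) : m ≠ 0 := by
  rintro rfl
  exact hk (by linear_combination -hm / 3)

/-- The values `m = ±1`, at which numerator and denominator of the cubic map share a factor, turn
the equation for `m` into `(1 ± k)² = 0`. -/
lemma param_sq_ne_one {k m : ℂ} (hk1 : k ^ 2 ≠ 1) (hm : k * m ^ 2 = (1 + k ^ 2) * m + 3 * k) :
    m ^ 2 ≠ 1 := by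
  intro h
  have h1 : (m - 1) * (m + 1) = 0 := by linear_combination h
  rcases mul_eq_zero.1 h1 with h1 | h1
  · have e : m = 1 := by linear_combination h1
    subst e
    have : (1 + k) ^ 2 = 0 := by linear_combination -hm
    have : 1 + k = 0 := by simpa using this
    exact hk1 (by linear_combination (k - 1) * this)
  · have e : m = -1 := by linear_combination h1
    subst e
    have : (1 - k) ^ 2 = 0 := by linear_combination hm
    have : 1 - k = 0 := by simpa using this
    exact hk1 (by linear_combination (-k - 1) * this)

/-- On a fibre the cubic of `reflForm_eq` is `3 k / m` times the cubic with roots `x, y, z`;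
distinctness plays no role in this direction. -/
lemma InFibre.reflForm_eq_zero {k m : ℂ} (hk : k ≠ 0)
    (hm : k * m ^ 2 = (1 + k ^ 2) * m + 3 * k) {x y z : ℂ × ℂ} (h : InFibre m x y z) :
    reflForm k x y z = 0 := by
  have hm0 := param_ne_zero hk hm
  obtain ⟨h1, h2⟩ := h
  rw [reflForm_eq k x y z rfl rfl rfl rfl]
  refine (mul_eq_zero.1 (?_ : m * _ = 0)).resolve_left hm0
  rw [h1, h2]
  linear_combination
    ((x.2 * y.2 * z.2) * x.1 ^ 3 - (x.1 * y.1 * z.1) * x.2 ^ 3) * hm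
    + 3 * k * (x.1 ^ 2 * x.2 * h1 - x.1 * x.2 ^ 2 * h2)

/-- The fibre equations are two linear equations for the symmetric functions of `y` and `z`. Their
solution is the cross product of the coefficient vectors, which is nonzero because `m² ≠ 1`. -/
lemma InFibre.exists_factor {m : ℂ} (hm1 : m ^ 2 ≠ 1) {x y z : ℂ × ℂ} (hx : x ≠ 0) (hy : y ≠ 0)
    (hz : z ≠ 0) (h : InFibre m x y z) :
    ∃ r : ℂ, r ≠ 0 ∧ y.1 * z.1 = r * (x.1 ^ 2 + m * x.2 ^ 2) ∧
      y.1 * z.2 + z.1 * y.2 = r * ((m ^ 2 - 1) * x.1 * x.2) ∧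
      y.2 * z.2 = r * (m * x.1 ^ 2 + x.2 ^ 2) := by
  obtain ⟨h1, h2⟩ := h
  obtain ⟨u, v⟩ := x
  obtain ⟨A, hA⟩ : ∃ A, A = y.1 * z.1 := ⟨_, rfl⟩
  obtain ⟨B, hB⟩ : ∃ A, A = y.1 * z.2 + z.1 * y.2 := ⟨_, rfl⟩
  obtain ⟨C, hC⟩ : ∃ A, A = y.2 * z.2 := ⟨_, rfl⟩
  have e1 : v * B + u * C = m * u * A := by rw [hA, hB, hC]; linear_combination h1
  have e2 : u * B + v * A = m * v * C := by rw [hA, hB, hC]; linear_combination h2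
  have hABC : ¬ (A = 0 ∧ B = 0 ∧ C = 0) := by
    rw [hA, hB, hC]
    obtain ⟨y1, y2⟩ := y
    obtain ⟨z1, z2⟩ := z
    simp only [ne_eq, Prod.mk_eq_zero, mul_eq_zero] at *
    rintro ⟨i | i, j, l | l⟩ <;> simp_all
  rw [← hA, ← hB, ← hC]
  simp only
  have m1 : A * (m * u ^ 2 + v ^ 2) = C * (u ^ 2 + m * v ^ 2) := by
    linear_combination v * e2 - u * e1
  have m2 : A * ((m ^ 2 - 1) * u * v) = B * (u ^ 2 + m * v ^ 2) := by
    linear_combination -m * v * e1 - u * e2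
  have m3 : C * ((m ^ 2 - 1) * u * v) = B * (m * u ^ 2 + v ^ 2) := by
    linear_combination -v * e1 - m * u * e2
  have hm1' : m ^ 2 - 1 ≠ 0 := sub_ne_zero.2 hm1
  suffices ∃ r : ℂ, A = r * (u ^ 2 + m * v ^ 2) ∧ B = r * ((m ^ 2 - 1) * u * v) ∧
      C = r * (m * u ^ 2 + v ^ 2) by
    obtain ⟨r, h1, h2, h3⟩ := this
    refine ⟨r, ?_, h1, h2, h3⟩
    rintro rfl
    exact hABC ⟨by simpa using h1, by simpa using h2, by simpa using h3⟩
  by_cases hp : u ^ 2 + m * v ^ 2 = 0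
  · have hq : m * u ^ 2 + v ^ 2 ≠ 0 := by
      intro hq
      have h3 : (m ^ 2 - 1) * u ^ 2 = 0 := by linear_combination m * hq - hp
      have h4 : (m ^ 2 - 1) * v ^ 2 = 0 := by linear_combination m * hp - hq
      simp only [mul_eq_zero, hm1', false_or, pow_eq_zero_iff two_ne_zero] at h3 h4
      exact hx (Prod.ext h3 h4)
    refine ⟨C / (m * u ^ 2 + v ^ 2), ?_, ?_, by field_simp⟩
    · field_simp
      linear_combination m1
    · field_simp
      linear_combination -m3
  · refine ⟨A / (u ^ 2 + m * v ^ 2), by field_simp, ?_, ?_⟩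
    · field_simp
      linear_combination -m2
    · field_simp
      linear_combination -m1

/-- Multiplicity in the fibre occurs exactly at the isotropic tangency points. -/
lemma InFibre.pairDet_mul_eq_zero_iff {k m : ℂ} (hk : k ≠ 0) (hk1 : k ^ 2 ≠ 1)
    (hm : k * m ^ 2 = (1 + k ^ 2) * m + 3 * k) {x y z : ℂ × ℂ} (hx : x ≠ 0) (hy : y ≠ 0)
    (hz : z ≠ 0) (h : InFibre m x y z) :
    pairDet x y * pairDet x z = 0 ↔ (x.1 ^ 2 - k * x.2 ^ 2) * (x.2 ^ 2 - k * x.1 ^ 2) = 0 := by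
  obtain ⟨r, hr, h1, h2, h3⟩ := h.exists_factor (param_sq_ne_one hk1 hm) hx hy hz
  have hm0 := param_ne_zero hk hm
  -- The left side is `k` times the value at `x` of the quadratic with roots `y, z`. That value is
  -- `r (m t⁴ + (3 - m²) t² + m)` in homogeneous form, and the equation for `m` makes it split.
  have : k * (pairDet x y * pairDet x z)
      = -(r * m) * ((x.1 ^ 2 - k * x.2 ^ 2) * (x.2 ^ 2 - k * x.1 ^ 2)) := by
    rw [pairDet, pairDet]
    linear_combination k * x.2 ^ 2 * h1 - k * x.1 * x.2 * h2 + k * x.1 ^ 2 * h3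
      - r * x.1 ^ 2 * x.2 ^ 2 * hm
  constructor
  · intro h
    rw [h, mul_zero] at this
    have hh := this.symm
    rwa [mul_eq_zero, or_iff_right (by simp [hr, hm0])] at hh
  · intro h
    rw [h, mul_zero] at this
    exact (mul_eq_zero.1 this).resolve_left hk

/-- The point completing the double point `s` to a fibre. -/
noncomputable def thirdPoint (m s : ℂ) : ℂ := (m - s ^ 2) / (2 * s)

/-- The second fibre equation, affinely `s² + 2 s w = m`, determines `w`; the first then follows
because `s` is a critical point (`hdet`). -/
lemma inFibre_double_iff {k m s : ℂ} (hk : k ≠ 0)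
    (hm : k * m ^ 2 = (1 + k ^ 2) * m + 3 * k) (hs : s ^ 2 = k ∨ k * s ^ 2 = 1) (w : ℂ × ℂ) :
    InFibre m (s, 1) (s, 1) w ↔ pairDet (thirdPoint m s, 1) w = 0 := by
  have hs0 : s ≠ 0 := by
    rintro rfl
    rcases hs with h | h
    · exact hk (by simpa using h.symm)
    · simp at h
  have hc : (s ^ 2 - k) * (1 - k * s ^ 2) = 0 := by
    rcases hs with h | h <;> simp [h]
  have hdet : m * s ^ 4 + (3 - m ^ 2) * s ^ 2 + m = 0 := by
    refine (mul_eq_zero.1 (?_ : k * _ = 0)).resolve_left hk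
    linear_combination -m * hc - s ^ 2 * hm
  have hthird : pairDet (thirdPoint m s, 1) w = ((m - s ^ 2) * w.2 - 2 * s * w.1) / (2 * s) := by
    simp only [pairDet, thirdPoint]
    field_simp
  rw [hthird, div_eq_zero_iff, or_iff_left (by simp [hs0])]
  simp only [InFibre]
  constructor
  · rintro ⟨-, h⟩
    linear_combination -h
  · intro h
    refine ⟨?_, by linear_combination -h⟩
    refine (mul_eq_zero.1 (?_ : (2 * s) * (_ - _) = 0)).resolve_left (by simp [hs0]) |> sub_eq_zero.1
    linear_combination w.2 * hdet - (1 - m * s ^ 2) * h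

/-! ### Lines, symmetries and tangents in the projective plane. -/

/-- The projective line with equation `n 0 * x + n 1 * y + n 2 * z = 0`. -/
def lineOf (n : Fin 3 → ℂ) : Submodule ℂ (Fin 3 → ℂ) :=
  LinearMap.ker (∑ i, n i • LinearMap.proj (R := ℂ) (φ := fun _ : Fin 3 => ℂ) i)

lemma mem_lineOf {n X : Fin 3 → ℂ} :
    X ∈ lineOf n ↔ n 0 * X 0 + n 1 * X 1 + n 2 * X 2 = 0 := by
  simp [lineOf, Fin.sum_univ_three]

lemma finrank_lineOf {n : Fin 3 → ℂ} (hn : n ≠ 0) : Module.finrank ℂ (lineOf n) = 2 := by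
  have h : (∑ i, n i • LinearMap.proj (R := ℂ) (φ := fun _ : Fin 3 => ℂ) i) ≠ 0 := by
    intro h
    refine hn (funext fun j => ?_)
    have := LinearMap.congr_fun h (Pi.single j 1)
    simpa [Finset.sum_apply, Pi.single_apply] using this
  have := Module.Dual.finrank_ker_add_one_of_ne_zero h
  rw [Module.finrank_fin_fun] at this
  rw [lineOf]
  omega

lemma finrank_span_sup_span {p q : Fin 3 → ℂ} (h : LinearIndependent ℂ ![p, q]) :
    Module.finrank ℂ ↥(Submodule.span ℂ {p} ⊔ Submodule.span ℂ {q}) = 2 := by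
  have := finrank_span_eq_card h
  rwa [Matrix.range_cons, Matrix.range_cons, Matrix.range_empty, Set.union_empty,
    Submodule.span_union, Fintype.card_fin] at this

lemma span_sup_span_eq_lineOf {n p q : Fin 3 → ℂ} (h : LinearIndependent ℂ ![p, q]) (hn : n ≠ 0)
    (hp : p ∈ lineOf n) (hq : q ∈ lineOf n) :
    Submodule.span ℂ {p} ⊔ Submodule.span ℂ {q} = lineOf n := by
  apply Submodule.eq_of_le_of_finrank_eq
  · rw [sup_le_iff, Submodule.span_singleton_le_iff_mem, Submodule.span_singleton_le_iff_mem]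
    exact ⟨hp, hq⟩
  · rw [finrank_span_sup_span h, finrank_lineOf hn]

/-- The symmetry with respect to the non-isotropic line `lineOf n`. -/
noncomputable def reflection (n : Fin 3 → ℂ) : (Fin 3 → ℂ) →ₗ[ℂ] (Fin 3 → ℂ) where
  toFun X :=
    ![X 0 - 2 * (n 0 * X 0 + n 1 * X 1 + n 2 * X 2) / (n 0 ^ 2 + n 1 ^ 2) * n 0,
      X 1 - 2 * (n 0 * X 0 + n 1 * X 1 + n 2 * X 2) / (n 0 ^ 2 + n 1 ^ 2) * n 1, X 2]
  map_add' X Y := by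
    ext i
    fin_cases i <;> simp <;> ring
  map_smul' c X := by
    ext i
    fin_cases i <;> simp <;> ring

lemma reflection_zero (n X : Fin 3 → ℂ) : reflection n X 0 =
    X 0 - 2 * (n 0 * X 0 + n 1 * X 1 + n 2 * X 2) / (n 0 ^ 2 + n 1 ^ 2) * n 0 := rfl

lemma reflection_one (n X : Fin 3 → ℂ) : reflection n X 1 =
    X 1 - 2 * (n 0 * X 0 + n 1 * X 1 + n 2 * X 2) / (n 0 ^ 2 + n 1 ^ 2) * n 1 := rfl

lemma reflection_two (n X : Fin 3 → ℂ) : reflection n X 2 = X 2 := rfl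

lemma isSymmetry_reflection {n : Fin 3 → ℂ} (hN : n 0 ^ 2 + n 1 ^ 2 ≠ 0) :
    IsSymmetry (lineOf n) (reflection n) where
  affine X := reflection_two n X
  isometric X hX := by
    rw [reflection_zero, reflection_one, hX]
    field_simp
    ring
  involutive X := by
    ext i
    fin_cases i
    · simp only [Fin.zero_eta, reflection_zero, reflection_one, reflection_two]
      field_simp
      ring
    · simp only [Fin.mk_one, reflection_zero, reflection_one, reflection_two]
      field_simp
      ring
    · simp only [Fin.reduceFinMk, reflection_two]
  nontrivial h := by
    have h0 := congr_fun (LinearMap.congr_fun h ![n 0, n 1, 0]) 0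
    have h1 := congr_fun (LinearMap.congr_fun h ![n 0, n 1, 0]) 1
    rw [reflection_zero] at h0
    rw [reflection_one] at h1
    simp only [Matrix.cons_val_zero, Matrix.cons_val_one, Matrix.cons_val, LinearMap.id_apply,
      mul_zero, add_zero] at h0 h1
    rw [← pow_two, ← pow_two, mul_div_assoc, div_self hN] at h0 h1
    have e0 : n 0 = 0 := by linear_combination -h0 / 2
    have e1 : n 1 = 0 := by linear_combination -h1 / 2
    exact hN (by rw [e0, e1]; ring)
  fixes X hX := by
    rw [mem_lineOf] at hX
    ext i
    fin_cases i
    · simp only [Fin.zero_eta, reflection_zero, hX]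
      simp
    · simp only [Fin.mk_one, reflection_one, hX]
      simp
    · simp only [Fin.reduceFinMk, reflection_two]

/-- The symmetry with respect to a non-isotropic line is unique. -/
lemma IsSymmetry.eq_reflection {n : Fin 3 → ℂ} (hN : n 0 ^ 2 + n 1 ^ 2 ≠ 0)
    {σ : (Fin 3 → ℂ) →ₗ[ℂ] (Fin 3 → ℂ)} (h : IsSymmetry (lineOf n) σ) : σ = reflection n := by
  obtain ⟨N, hNe⟩ : ∃ N, N = n 0 ^ 2 + n 1 ^ 2 := ⟨_, rfl⟩
  have hN' : N ≠ 0 := hNe ▸ hN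
  -- A direction normal to the line, scaled so that the linear form `n` takes the value `1` on it.
  -- As `σ` fixes `lineOf n`, it is the identity plus `n` times `w = σ e - e`.
  obtain ⟨e, he⟩ : ∃ e : Fin 3 → ℂ, e = ![n 0 / N, n 1 / N, 0] := ⟨_, rfl⟩
  have e0 : e 0 = n 0 / N := by simp [he]
  have e1 : e 1 = n 1 / N := by simp [he]
  have e2 : e 2 = 0 := by simp [he]
  obtain ⟨w, hw⟩ : ∃ w, w = σ e - e := ⟨_, rfl⟩
  have hσ : ∀ X, σ X = X + (n 0 * X 0 + n 1 * X 1 + n 2 * X 2) • w := by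
    intro X
    have hmem : X - (n 0 * X 0 + n 1 * X 1 + n 2 * X 2) • e ∈ lineOf n := by
      rw [mem_lineOf]
      simp only [Pi.sub_apply, Pi.smul_apply, smul_eq_mul, e0, e1, e2]
      field_simp
      rw [hNe]
      ring
    have := h.fixes _ hmem
    rw [map_sub, map_smul] at this
    rw [hw, smul_sub, ← sub_eq_zero]
    rw [← sub_eq_zero] at this
    rw [← this]
    abel
  have w2 : w 2 = 0 := by rw [hw]; simp [h.affine]
  have i1 := h.isometric e e2
  -- The second test vector is `e` plus a direction of the line; comparing with `i1` shows that `w`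
  -- is parallel to `(n 0, n 1)`.
  have i2 := h.isometric ![n 0 / N - n 1, n 1 / N + n 0, 0] (by simp)
  rw [hσ] at i1 i2
  simp only [Pi.add_apply, Pi.smul_apply, smul_eq_mul, e0, e1, e2, Matrix.cons_val_zero,
    Matrix.cons_val_one, Matrix.cons_val] at i1 i2
  have s1 : n 0 * (n 0 / N) + n 1 * (n 1 / N) + n 2 * 0 = 1 := by
    field_simp
    rw [hNe]
    ring
  have s2 : n 0 * (n 0 / N - n 1) + n 1 * (n 1 / N + n 0) + n 2 * 0 = 1 := by
    rw [← s1]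
    ring
  rw [s1] at i1
  rw [s2] at i2
  have o : n 0 * w 1 = n 1 * w 0 := by linear_combination (i2 - i1) / 2
  obtain ⟨κ, hκ⟩ : ∃ κ, κ = (n 0 * w 0 + n 1 * w 1) / N := ⟨_, rfl⟩
  have w0 : w 0 = κ * n 0 := by
    rw [hκ]
    field_simp
    rw [hNe]
    linear_combination -n 1 * o
  have w1 : w 1 = κ * n 1 := by
    rw [hκ]
    field_simp
    rw [hNe]
    linear_combination n 0 * o
  have hκ2 : κ * (κ * N + 2) = 0 := by
    rw [w0, w1] at i1
    linear_combination i1 - 2 * κ * s1 + κ ^ 2 * hNe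
  rcases mul_eq_zero.1 hκ2 with hk | hk
  · exfalso
    have : w = 0 := by
      ext i
      fin_cases i
      · simpa [hk] using w0
      · simpa [hk] using w1
      · exact w2
    refine h.nontrivial (LinearMap.ext fun X => ?_)
    rw [hσ X, this]
    simp
  · have hk' : κ = -2 / N := by
      field_simp
      linear_combination hk
    refine LinearMap.ext fun X => ?_
    rw [hσ X]
    ext i
    fin_cases i
    · simp only [Fin.zero_eta, reflection_zero, Pi.add_apply, Pi.smul_apply, smul_eq_mul, w0, hk',
        ← hNe]
      ring
    · simp only [Fin.mk_one, reflection_one, Pi.add_apply, Pi.smul_apply, smul_eq_mul, w1, hk',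
        ← hNe]
      ring
    · simp only [Fin.reduceFinMk, reflection_two, Pi.add_apply, Pi.smul_apply, smul_eq_mul, w2]
      ring

/-- The symmetry fixes the common point `p`, so only the image of `q` has to be tested against the
line `lineOf n'`. -/
lemma areSymmetric_lineOf_iff {n n' p q : Fin 3 → ℂ} (hN : n 0 ^ 2 + n 1 ^ 2 ≠ 0)
    (hp : p ∈ lineOf n) (hn' : n' ≠ 0) (hp' : p ∈ lineOf n') (h : LinearIndependent ℂ ![p, q]) :
    AreSymmetric (lineOf n) (Submodule.span ℂ {p} ⊔ Submodule.span ℂ {q}) (lineOf n') ↔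
      (n' 0 * q 0 + n' 1 * q 1 + n' 2 * q 2) * (n 0 ^ 2 + n 1 ^ 2) =
        2 * (n 0 * q 0 + n 1 * q 1 + n 2 * q 2) * (n 0 * n' 0 + n 1 * n' 1) := by
  have key : reflection n q ∈ lineOf n' ↔
      (n' 0 * q 0 + n' 1 * q 1 + n' 2 * q 2) * (n 0 ^ 2 + n 1 ^ 2) =
        2 * (n 0 * q 0 + n 1 * q 1 + n 2 * q 2) * (n 0 * n' 0 + n 1 * n' 1) := by
    rw [mem_lineOf, reflection_zero, reflection_one, reflection_two]
    have : n' 0 * (q 0 - 2 * (n 0 * q 0 + n 1 * q 1 + n 2 * q 2) / (n 0 ^ 2 + n 1 ^ 2) * n 0) +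
        n' 1 * (q 1 - 2 * (n 0 * q 0 + n 1 * q 1 + n 2 * q 2) / (n 0 ^ 2 + n 1 ^ 2) * n 1) +
        n' 2 * q 2 = ((n' 0 * q 0 + n' 1 * q 1 + n' 2 * q 2) * (n 0 ^ 2 + n 1 ^ 2) -
        2 * (n 0 * q 0 + n 1 * q 1 + n 2 * q 2) * (n 0 * n' 0 + n 1 * n' 1)) /
        (n 0 ^ 2 + n 1 ^ 2) := by
      field_simp
      ring
    rw [this, div_eq_zero_iff, or_iff_left hN, sub_eq_zero]
  rw [← key]
  constructor
  · rintro ⟨σ, hσ, hl⟩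
    rw [hσ.eq_reflection hN] at hl
    rw [← hl]
    exact Submodule.mem_map_of_mem (Submodule.mem_sup_right (Submodule.mem_span_singleton_self q))
  · intro hq
    have hs := isSymmetry_reflection hN
    refine ⟨reflection n, hs, ?_⟩
    have hinj : Function.Injective (reflection n) :=
      Function.LeftInverse.injective (g := reflection n) hs.involutive
    apply Submodule.eq_of_le_of_finrank_eq
    · rw [Submodule.map_sup, Submodule.map_span, Submodule.map_span, Set.image_singleton,
        Set.image_singleton, hs.fixes p hp, sup_le_iff, Submodule.span_singleton_le_iff_mem,
        Submodule.span_singleton_le_iff_mem]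
      exact ⟨hp', hq⟩
    · rw [← (Submodule.equivMapOfInjective _ hinj _).finrank_eq, finrank_span_sup_span h, finrank_lineOf hn']

lemma tangentLine_eq_lineOf (a b : ℝ) (lam : ℂ) {v : Fin 3 → ℂ} (hv : v ≠ 0) :
    tangentLine a b lam (Projectivization.mk ℂ v hv) =
      lineOf ![1 / ((a : ℂ) ^ 2 + lam) * v 0, 1 / ((b : ℂ) ^ 2 + lam) * v 1, -v 2] := by
  ext X
  rw [tangentLine, Projectivization.submodule_mk, LinearMap.BilinForm.mem_orthogonal_iff,
    mem_lineOf]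
  have hB : ∀ c : ℂ, conicForm a b lam (c • v) X = c * (1 / ((a : ℂ) ^ 2 + lam) * v 0 * X 0 +
      1 / ((b : ℂ) ^ 2 + lam) * v 1 * X 1 + -v 2 * X 2) := by
    intro c
    rw [map_smul, LinearMap.smul_apply, smul_eq_mul, conicForm, Matrix.toBilin'_apply]
    simp only [Fin.sum_univ_three, Matrix.diagonal]
    simp
    left
    ring
  constructor
  · intro h
    have := h v (Submodule.mem_span_singleton_self v)
    change conicForm a b lam v X = 0 at this
    rw [← one_smul ℂ v, hB 1] at this
    simpa using this
  · intro h Y hY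
    obtain ⟨c, rfl⟩ := Submodule.mem_span_singleton.1 hY
    change conicForm a b lam (c • v) X = 0
    rw [hB c]
    simp only [Matrix.cons_val_zero, Matrix.cons_val_one, Matrix.cons_val] at h
    rw [h, mul_zero]

lemma mk_mem_conic_iff (a b : ℝ) (lam : ℂ) {v : Fin 3 → ℂ} (hv : v ≠ 0) :
    Projectivization.mk ℂ v hv ∈ conic a b lam ↔
      1 / ((a : ℂ) ^ 2 + lam) * v 0 ^ 2 + 1 / ((b : ℂ) ^ 2 + lam) * v 1 ^ 2 - v 2 ^ 2 = 0 := by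
  obtain ⟨c, hc⟩ := Projectivization.exists_smul_eq_mk_rep ℂ v hv
  rw [conic, Set.mem_ofPred_eq, ← hc, Units.smul_def, map_smul, map_smul, LinearMap.smul_apply,
    smul_eq_mul, smul_eq_mul, mul_eq_zero, or_iff_right c.ne_zero, mul_eq_zero,
    or_iff_right c.ne_zero, conicForm, Matrix.toBilin'_apply]
  simp only [Fin.sum_univ_three, Matrix.diagonal]
  simp
  constructor <;> intro h <;> linear_combination h

lemma cross_eq_of_lineOf_eq {n n' : Fin 3 → ℂ} (h : lineOf n = lineOf n') (i j : Fin 3) :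
    n i * n' j = n j * n' i := by
  have h1 : (![n 1, -n 0, 0] : Fin 3 → ℂ) ∈ lineOf n' := by
    rw [← h, mem_lineOf]; simp; ring
  have h2 : (![n 2, 0, -n 0] : Fin 3 → ℂ) ∈ lineOf n' := by
    rw [← h, mem_lineOf]; simp; ring
  have h3 : (![0, n 2, -n 1] : Fin 3 → ℂ) ∈ lineOf n' := by
    rw [← h, mem_lineOf]; simp; ring
  rw [mem_lineOf] at h1 h2 h3
  simp only [Matrix.cons_val_zero, Matrix.cons_val_one, Matrix.cons_val] at h1 h2 h3
  fin_cases i <;> fin_cases j <;> simp only [Fin.zero_eta, Fin.mk_one, Fin.reduceFinMk]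
  · linear_combination -h1
  · linear_combination -h2
  · linear_combination h1
  · linear_combination -h3
  · linear_combination h2
  · linear_combination h3

/-- The dual equation of the conic `C_lam`. -/
lemma isTangentToConic_lineOf_iff {a b : ℝ} {lam : ℂ} (hA : (a : ℂ) ^ 2 + lam ≠ 0)
    (hB : (b : ℂ) ^ 2 + lam ≠ 0) {n : Fin 3 → ℂ} (hn : n ≠ 0) :
    IsTangentToConic a b lam (lineOf n) ↔
      n 0 ^ 2 * ((a : ℂ) ^ 2 + lam) + n 1 ^ 2 * ((b : ℂ) ^ 2 + lam) = n 2 ^ 2 := by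
  constructor
  · rintro ⟨P, hP, hL⟩
    induction P using Projectivization.ind with
    | h v hv =>
      rw [mk_mem_conic_iff] at hP
      rw [tangentLine_eq_lineOf] at hL
      have c := cross_eq_of_lineOf_eq hL
      have c01 := c 0 1
      have c02 := c 0 2
      have c12 := c 1 2
      simp only [Matrix.cons_val_zero, Matrix.cons_val_one, Matrix.cons_val] at c01 c02 c12
      generalize (a : ℂ) ^ 2 + lam = A at *
      generalize (b : ℂ) ^ 2 + lam = B at *
      have d01 : n 0 * v 1 * A = n 1 * v 0 * B := by
        field_simp at c01
        linear_combination c01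
      have d02 : -n 0 * v 2 * A = n 2 * v 0 := by
        field_simp at c02
        linear_combination c02
      have d12 : -n 1 * v 2 * B = n 2 * v 1 := by
        field_simp at c12
        linear_combination c12
      have hQ : v 0 ^ 2 * B + v 1 ^ 2 * A = v 2 ^ 2 * A * B := by
        field_simp at hP
        linear_combination hP
      rw [← sub_eq_zero]
      have e0 : v 0 ≠ 0 ∨ v 1 ≠ 0 ∨ v 2 ≠ 0 := by
        by_contra! hcon
        refine hv (funext fun i => ?_)
        fin_cases i
        exacts [hcon.1, hcon.2.1, hcon.2.2]
      -- Each nonzero coordinate of the contact point gives its own multiple of the dual equation.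
      rcases e0 with e | e | e
      · refine (mul_eq_zero.1 (?_ : (B * v 0 ^ 2) * _ = 0)).resolve_left (by simp [hB, e])
        linear_combination n 0 ^ 2 * A * hQ - (n 0 * v 1 * A + n 1 * v 0 * B) * d01
          - B * (n 0 * v 2 * A - n 2 * v 0) * d02
      · refine (mul_eq_zero.1 (?_ : (A * v 1 ^ 2) * _ = 0)).resolve_left (by simp [hA, e])
        linear_combination n 1 ^ 2 * B * hQ + (n 0 * v 1 * A + n 1 * v 0 * B) * d01
          - A * (n 1 * v 2 * B - n 2 * v 1) * d12
      · refine (mul_eq_zero.1 (?_ : (A * B * v 2 ^ 2) * _ = 0)).resolve_left (by simp [hA, hB, e])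
        linear_combination n 2 ^ 2 * hQ - B * (n 0 * v 2 * A - n 2 * v 0) * d02
          - A * (n 1 * v 2 * B - n 2 * v 1) * d12
  · intro h
    -- The contact point is the pole of the line with respect to `C_lam`.
    have hv : (![((a : ℂ) ^ 2 + lam) * n 0, ((b : ℂ) ^ 2 + lam) * n 1, -n 2] : Fin 3 → ℂ) ≠ 0 := by
      intro h0
      have e0 := congr_fun h0 0
      have e1 := congr_fun h0 1
      have e2 := congr_fun h0 2
      simp [hA, hB] at e0 e1 e2
      refine hn (funext fun i => ?_)
      fin_cases i
      exacts [e0, e1, e2]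
    refine ⟨Projectivization.mk ℂ _ hv, ?_, ?_⟩
    · rw [mk_mem_conic_iff]
      simp only [Matrix.cons_val_zero, Matrix.cons_val_one, Matrix.cons_val]
      field_simp
      linear_combination h
    · rw [tangentLine_eq_lineOf]
      congr 1
      ext i
      fin_cases i <;> simp [hA, hB]

/-! ### Parametrization of the ellipse and of its chords. -/

/-- The rational parametrization of the ellipse. -/
noncomputable def ellipseVec (a b : ℝ) (x : ℂ × ℂ) : Fin 3 → ℂ :=
  ![a * (x.1 ^ 2 + x.2 ^ 2), -Complex.I * b * (x.1 ^ 2 - x.2 ^ 2), 2 * (x.1 * x.2)]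

/-- The coefficients of the chord through the points with parameters `x` and `y`
(of the tangent line if `x = y`). -/
noncomputable def chordCovec (a b : ℝ) (x y : ℂ × ℂ) : Fin 3 → ℂ :=
  ![(x.1 * y.1 + x.2 * y.2) / a, -Complex.I * (x.1 * y.1 - x.2 * y.2) / b,
    -(x.1 * y.2 + y.1 * x.2)]

/-- The eccentricity parameter `(a - b) / (a + b)`. -/
noncomputable def eccParam (a b : ℝ) : ℂ := ((a : ℂ) - b) / (a + b)

lemma prod_ne_zero_iff {x : ℂ × ℂ} : x ≠ 0 ↔ x.1 ≠ 0 ∨ x.2 ≠ 0 := by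
  rw [ne_eq, Prod.ext_iff, not_and_or]
  rfl

section

variable {a b : ℝ} (ha : 0 < a) (hb : 0 < b)

lemma ofReal_ne_zero_of_pos (ha : 0 < a) : (a : ℂ) ≠ 0 := Complex.ofReal_ne_zero.2 ha.ne'

lemma ofReal_add_ne_zero (ha : 0 < a) (hb : 0 < b) : (a : ℂ) + b ≠ 0 := by
  rw [← Complex.ofReal_add]
  exact ofReal_ne_zero_of_pos (add_pos ha hb)

lemma eccParam_mul (ha : 0 < a) (hb : 0 < b) : eccParam a b * (a + b) = a - b := by
  have := ofReal_add_ne_zero ha hb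
  rw [eccParam]
  field_simp

lemma eccParam_ne_zero (ha : 0 < a) (hb : 0 < b) (hab : a ≠ b) : eccParam a b ≠ 0 := by
  rw [eccParam]
  refine div_ne_zero (sub_ne_zero.2 ?_) (ofReal_add_ne_zero ha hb)
  exact_mod_cast hab

lemma eccParam_sq_ne_one (ha : 0 < a) (hb : 0 < b) : eccParam a b ^ 2 ≠ 1 := by
  intro h
  have h2 := eccParam_mul ha hb
  have : (4 : ℂ) * a * b = 0 := by
    linear_combination (eccParam a b * (a + b) + (a - b)) * h2 - ((a : ℂ) + b) ^ 2 * h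
  simp [ha.ne', hb.ne'] at this

lemma ellipseVec_ne_zero (ha : 0 < a) (hb : 0 < b) {x : ℂ × ℂ} (hx : x ≠ 0) :
    ellipseVec a b x ≠ 0 := by
  intro h
  have h0 := congr_fun h 0
  have h1 := congr_fun h 1
  simp [ellipseVec, ha.ne', hb.ne'] at h0 h1
  rw [prod_ne_zero_iff] at hx
  have e1 : x.1 ^ 2 = 0 := by linear_combination (h0 + h1) / 2
  have e2 : x.2 ^ 2 = 0 := by linear_combination (h0 - h1) / 2
  simp at e1 e2
  tauto

lemma chordCovec_ne_zero (ha : 0 < a) (hb : 0 < b) {x y : ℂ × ℂ} (hx : x ≠ 0) (hy : y ≠ 0) :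
    chordCovec a b x y ≠ 0 := by
  intro h
  have h0 := congr_fun h 0
  have h1 := congr_fun h 1
  have h2 := congr_fun h 2
  simp [chordCovec, ha.ne', hb.ne'] at h0 h1 h2
  have e1 : x.1 * y.1 = 0 := by linear_combination (h0 + h1) / 2
  have e2 : x.2 * y.2 = 0 := by linear_combination (h0 - h1) / 2
  rw [prod_ne_zero_iff] at hx hy
  simp only [mul_eq_zero] at e1 e2
  rcases e1 with e1 | e1 <;> rcases e2 with e2 | e2 <;> simp_all

/-- Restricted to the ellipse, the equation of the chord is a binary quadratic with roots `x` and
`y`. -/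
lemma chordCovec_apply_ellipseVec (ha : 0 < a) (hb : 0 < b) (x y z : ℂ × ℂ) :
    chordCovec a b x y 0 * ellipseVec a b z 0 + chordCovec a b x y 1 * ellipseVec a b z 1 +
      chordCovec a b x y 2 * ellipseVec a b z 2 = 2 * (pairDet x z * pairDet y z) := by
  have := ofReal_ne_zero_of_pos ha
  have := ofReal_ne_zero_of_pos hb
  simp [chordCovec, ellipseVec, pairDet]
  field_simp
  rw [Complex.I_sq]
  ring

lemma chordCovec_dot (ha : 0 < a) (hb : 0 < b) (x y z w : ℂ × ℂ) :
    chordCovec a b x y 0 * chordCovec a b z w 0 + chordCovec a b x y 1 * chordCovec a b z w 1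
      = ((x.1 * y.1 + x.2 * y.2) * (z.1 * w.1 + z.2 * w.2)) / (a : ℂ) ^ 2 -
        ((x.1 * y.1 - x.2 * y.2) * (z.1 * w.1 - z.2 * w.2)) / (b : ℂ) ^ 2 := by
  have := ofReal_ne_zero_of_pos ha
  have := ofReal_ne_zero_of_pos hb
  simp [chordCovec]
  field_simp
  rw [Complex.I_sq]
  ring

lemma isIsotropic_lineOf_iff (n : Fin 3 → ℂ) : IsIsotropic (lineOf n) ↔ n 0 ^ 2 + n 1 ^ 2 = 0 := by
  rw [IsIsotropic, mem_lineOf, mem_lineOf, ← mul_eq_zero]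
  simp only [Matrix.cons_val_zero, Matrix.cons_val_one, Matrix.cons_val]
  constructor <;> intro h
  · linear_combination h + n 1 ^ 2 * Complex.I_sq
  · linear_combination h - n 1 ^ 2 * Complex.I_sq

/-- Up to the factor `(a + b) / (a b)`, the two factors are the values of the chord equation at the
two cyclic points; this is the origin of the parameter `k`. -/
lemma chordCovec_norm (ha : 0 < a) (hb : 0 < b) (x y : ℂ × ℂ) :
    chordCovec a b x y 0 ^ 2 + chordCovec a b x y 1 ^ 2 = (((a : ℂ) + b) / (a * b)) ^ 2 *
      ((x.1 * y.1 - eccParam a b * (x.2 * y.2)) * (x.2 * y.2 - eccParam a b * (x.1 * y.1))) := by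
  have := ofReal_ne_zero_of_pos ha
  have := ofReal_ne_zero_of_pos hb
  have := ofReal_add_ne_zero ha hb
  rw [pow_two, pow_two, chordCovec_dot ha hb, eccParam]
  field_simp
  ring

lemma isIsotropic_chord_iff (ha : 0 < a) (hb : 0 < b) (x y : ℂ × ℂ) :
    IsIsotropic (lineOf (chordCovec a b x y)) ↔
      (x.1 * y.1 - eccParam a b * (x.2 * y.2)) * (x.2 * y.2 - eccParam a b * (x.1 * y.1)) = 0 := by
  rw [isIsotropic_lineOf_iff, chordCovec_norm ha hb, mul_eq_zero, or_iff_right]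
  exact pow_ne_zero _ (div_ne_zero (ofReal_add_ne_zero ha hb)
    (mul_ne_zero (ofReal_ne_zero_of_pos ha) (ofReal_ne_zero_of_pos hb)))

/-- The point of the ellipse with homogeneous parameter `x`. -/
noncomputable def ellipsePt (ha : 0 < a) (hb : 0 < b) (x : ℂ × ℂ) (hx : x ≠ 0) : CP2 :=
  Projectivization.mk ℂ (ellipseVec a b x) (ellipseVec_ne_zero ha hb hx)

lemma ellipsePt_mem {x : ℂ × ℂ} (hx : x ≠ 0) : ellipsePt ha hb x hx ∈ ellipse a b := by
  have := ofReal_ne_zero_of_pos ha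
  have := ofReal_ne_zero_of_pos hb
  rw [ellipse, ellipsePt, mk_mem_conic_iff]
  simp [ellipseVec]
  field_simp
  rw [Complex.I_sq]
  ring

lemma exists_ellipsePt {P : CP2} (hP : P ∈ ellipse a b) :
    ∃ x : ℂ × ℂ, ∃ hx : x ≠ 0, P = ellipsePt ha hb x hx := by
  have ha' := ofReal_ne_zero_of_pos ha
  have hb' := ofReal_ne_zero_of_pos hb
  induction P using Projectivization.ind with
  | h v hv =>
    rw [ellipse, mk_mem_conic_iff] at hP
    simp only [add_zero] at hP
    -- In the coordinates `x/a ± i y/b` the conic is `p q = z²`, so the parameters are square roots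
    -- of `p / 2` and `q / 2` with product `z / 2`.
    obtain ⟨p, hp⟩ : ∃ p, p = v 0 / a + Complex.I * (v 1 / b) := ⟨_, rfl⟩
    obtain ⟨q, hq⟩ : ∃ q, q = v 0 / a - Complex.I * (v 1 / b) := ⟨_, rfl⟩
    have hpq : p * q = v 2 ^ 2 := by
      rw [hp, hq]
      linear_combination hP - (v 1 / b) ^ 2 * Complex.I_sq
    have v0 : v 0 = a * (p + q) / 2 := by
      rw [hp, hq]
      field_simp
      ring
    have v1 : v 1 = -Complex.I * b * (p - q) / 2 := by
      have hw : b * (v 1 / b) = v 1 := by field_simp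
      rw [hp, hq]
      linear_combination (b * (v 1 / b)) * Complex.I_sq - hw
    suffices ∃ x : ℂ × ℂ, x.1 ^ 2 = p / 2 ∧ x.2 ^ 2 = q / 2 ∧ 2 * (x.1 * x.2) = v 2 by
      obtain ⟨x, h1, h2, h3⟩ := this
      have hvec : ellipseVec a b x = v := by
        ext i
        fin_cases i
        · simp only [ellipseVec, Fin.zero_eta, Matrix.cons_val_zero, h1, h2, v0]
          ring
        · simp only [ellipseVec, Fin.mk_one, Matrix.cons_val_one, Matrix.cons_val_zero, h1, h2, v1]
          ring
        · exact h3
      have hx : x ≠ 0 := by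
        rintro rfl
        exact hv (by rw [← hvec]; ext i; fin_cases i <;> simp [ellipseVec])
      exact ⟨x, hx, by simp only [ellipsePt, hvec]⟩
    obtain ⟨s, hs⟩ := IsAlgClosed.exists_pow_nat_eq (p / 2) two_pos
    by_cases hs0 : s = 0
    · have p0 : p = 0 := by
        rw [hs0] at hs
        linear_combination -2 * hs
      have v2 : v 2 = 0 := by simpa [p0] using hpq.symm
      obtain ⟨t, ht⟩ := IsAlgClosed.exists_pow_nat_eq (q / 2) two_pos
      exact ⟨(s, t), hs, ht, by simp [hs0, v2]⟩
    · refine ⟨(s, v 2 / (2 * s)), hs, ?_, by field_simp⟩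
      have p0 : p = 2 * s ^ 2 := by linear_combination -2 * hs
      simp only
      field_simp
      rw [← hpq, p0]

lemma ellipsePt_eq_iff {x y : ℂ × ℂ} (hx : x ≠ 0) (hy : y ≠ 0) :
    ellipsePt ha hb x hx = ellipsePt ha hb y hy ↔ pairDet x y = 0 := by
  rw [ellipsePt, ellipsePt, Projectivization.mk_eq_mk_iff']
  constructor
  · rintro ⟨c, hc⟩
    have h0 := congr_fun hc 0
    have h1 := congr_fun hc 1
    have h2 := congr_fun hc 2
    simp [ellipseVec] at h0 h1 h2
    have h0' : (a : ℂ) * (c * (y.1 ^ 2 + y.2 ^ 2) - (x.1 ^ 2 + x.2 ^ 2)) = 0 := by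
      linear_combination h0
    have h1' : Complex.I * b * (c * (y.1 ^ 2 - y.2 ^ 2) - (x.1 ^ 2 - x.2 ^ 2)) = 0 := by
      linear_combination h1
    simp [ha.ne', hb.ne'] at h0' h1'
    rw [← pow_eq_zero_iff two_ne_zero, pairDet]
    linear_combination -(y.2 ^ 2) * (h0' + h1') / 2 - y.1 ^ 2 * (h0' - h1') / 2
      + y.1 * y.2 * h2
  · intro h
    obtain ⟨c, hc, rfl⟩ := (pairDet_eq_zero_iff hx hy).1 h
    refine ⟨(c ^ 2)⁻¹, ?_⟩
    ext i
    fin_cases i <;> simp [ellipseVec] <;> field_simp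

lemma linearIndependent_ellipseVec (ha : 0 < a) (hb : 0 < b) {x y : ℂ × ℂ} (hx : x ≠ 0) (hy : y ≠ 0)
    (h : pairDet x y ≠ 0) : LinearIndependent ℂ ![ellipseVec a b x, ellipseVec a b y] := by
  rw [LinearIndependent.pair_iff' (ellipseVec_ne_zero ha hb hx)]
  intro c hc
  rw [ne_eq, ← ellipsePt_eq_iff ha hb hx hy] at h
  refine h (Eq.symm ?_)
  rw [ellipsePt, ellipsePt, Projectivization.mk_eq_mk_iff']
  exact ⟨c, hc⟩

lemma lineThrough_ellipsePt {x y : ℂ × ℂ} (hx : x ≠ 0) (hy : y ≠ 0) (h : pairDet x y ≠ 0) :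
    lineThrough (ellipsePt ha hb x hx) (ellipsePt ha hb y hy) = lineOf (chordCovec a b x y) := by
  rw [lineThrough, ellipsePt, ellipsePt, Projectivization.submodule_mk,
    Projectivization.submodule_mk]
  apply span_sup_span_eq_lineOf (linearIndependent_ellipseVec ha hb hx hy h)
    (chordCovec_ne_zero ha hb hx hy)
  · rw [mem_lineOf, chordCovec_apply_ellipseVec ha hb, pairDet]
    ring
  · rw [mem_lineOf, chordCovec_apply_ellipseVec ha hb, pairDet, pairDet]
    ring

lemma ellipseTangent_ellipsePt {x : ℂ × ℂ} (hx : x ≠ 0) :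
    ellipseTangent a b (ellipsePt ha hb x hx) = lineOf (chordCovec a b x x) := by
  have := ofReal_ne_zero_of_pos ha
  have := ofReal_ne_zero_of_pos hb
  rw [ellipseTangent, ellipsePt, tangentLine_eq_lineOf]
  congr 1
  ext i
  fin_cases i
  · simp [ellipseVec, chordCovec]
    field_simp
  · simp [ellipseVec, chordCovec]
    field_simp
  · simp [ellipseVec, chordCovec]
    ring

lemma isIsotropic_ellipseTangent_iff {x : ℂ × ℂ} (hx : x ≠ 0) :
    IsIsotropic (ellipseTangent a b (ellipsePt ha hb x hx)) ↔
      (x.1 ^ 2 - eccParam a b * x.2 ^ 2) * (x.2 ^ 2 - eccParam a b * x.1 ^ 2) = 0 := by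
  rw [ellipseTangent_ellipsePt, isIsotropic_chord_iff ha hb]
  simp only [pow_two]

/-- After clearing denominators the reflection condition contains the factor `pairDet x y`;
cancelling it leaves `reflForm`, bilinear and symmetric in the far ends of the two chords. -/
lemma areSymmetric_chords_iff {x y z : ℂ × ℂ} (hx : x ≠ 0) (hy : y ≠ 0) (hz : z ≠ 0)
    (hxy : pairDet x y ≠ 0) (hxz : pairDet x z ≠ 0)
    (hiso : ¬ IsIsotropic (ellipseTangent a b (ellipsePt ha hb x hx))) :
    AreSymmetric (ellipseTangent a b (ellipsePt ha hb x hx))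
      (lineThrough (ellipsePt ha hb y hy) (ellipsePt ha hb x hx))
      (lineThrough (ellipsePt ha hb x hx) (ellipsePt ha hb z hz)) ↔
      reflForm (eccParam a b) x y z = 0 := by
  have ha' := ofReal_ne_zero_of_pos ha
  have hb' := ofReal_ne_zero_of_pos hb
  have hab' := ofReal_add_ne_zero ha hb
  rw [ellipseTangent_ellipsePt] at hiso ⊢
  rw [isIsotropic_lineOf_iff] at hiso
  rw [lineThrough_ellipsePt ha hb hx hz hxz, lineThrough, ellipsePt, ellipsePt,
    Projectivization.submodule_mk, Projectivization.submodule_mk, sup_comm,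
    areSymmetric_lineOf_iff hiso _ (chordCovec_ne_zero ha hb hx hz) _
      (linearIndependent_ellipseVec ha hb hx hy hxy)]
  rotate_left
  · rw [mem_lineOf, chordCovec_apply_ellipseVec ha hb, pairDet]
    ring
  · rw [mem_lineOf, chordCovec_apply_ellipseVec ha hb, pairDet]
    ring
  rw [chordCovec_apply_ellipseVec ha hb, chordCovec_apply_ellipseVec ha hb,
    chordCovec_dot ha hb, ← sub_eq_zero, pow_two (chordCovec a b x x 0),
    pow_two (chordCovec a b x x 1), chordCovec_dot ha hb]
  have key : 2 * (pairDet x y * pairDet z y) *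
        ((x.1 * x.1 + x.2 * x.2) * (x.1 * x.1 + x.2 * x.2) / (a : ℂ) ^ 2 -
        (x.1 * x.1 - x.2 * x.2) * (x.1 * x.1 - x.2 * x.2) / (b : ℂ) ^ 2) -
      2 * (2 * (pairDet x y * pairDet x y)) *
        ((x.1 * x.1 + x.2 * x.2) * (x.1 * z.1 + x.2 * z.2) / (a : ℂ) ^ 2 -
        (x.1 * x.1 - x.2 * x.2) * (x.1 * z.1 - x.2 * z.2) / (b : ℂ) ^ 2) =
      2 * (((a : ℂ) + b) / (a * b)) ^ 2 * pairDet x y * reflForm (eccParam a b) x y z := by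
    rw [eccParam, reflForm, pairDet, pairDet]
    field_simp
    ring
  rw [key, mul_eq_zero, or_iff_right]
  exact mul_ne_zero (mul_ne_zero two_ne_zero (pow_ne_zero _ (div_ne_zero hab'
    (mul_ne_zero ha' hb')))) hxy

end

/-! ### The two fibre parameters and the two caustics. -/

section

variable {a b : ℝ}

/-- The parameter of the fibration of the triangular orbits with caustic `γ_j`. -/
noncomputable def fibreParam (a b : ℝ) (j : Fin 2) : ℂ :=
  causticParam a b j * ((a : ℂ) ^ 2 - b ^ 2) / ((a : ℂ) ^ 2 * b ^ 2)

lemma sq_sub_sq_ne_zero (ha : 0 < a) (hb : 0 < b) (hab : a ≠ b) : (a : ℂ) ^ 2 - b ^ 2 ≠ 0 := by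
  have : (a : ℂ) ^ 2 - b ^ 2 = (a - b) * (a + b) := by ring
  rw [this]
  exact mul_ne_zero (sub_ne_zero.2 (by exact_mod_cast hab)) (ofReal_add_ne_zero ha hb)

lemma fibreParam_zero (ha : 0 < a) (hb : 0 < b) (hab : a ≠ b) : fibreParam a b 0 =
    ((a : ℂ) ^ 2 + b ^ 2 - 2 * (√(a ^ 4 - a ^ 2 * b ^ 2 + b ^ 4) : ℝ)) / (a ^ 2 - b ^ 2) := by
  have := ofReal_ne_zero_of_pos ha
  have := ofReal_ne_zero_of_pos hb
  have := sq_sub_sq_ne_zero ha hb hab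
  simp only [fibreParam, causticParam, Matrix.cons_val_zero]
  push_cast
  field_simp

lemma fibreParam_one (ha : 0 < a) (hb : 0 < b) (hab : a ≠ b) : fibreParam a b 1 =
    ((a : ℂ) ^ 2 + b ^ 2 + 2 * (√(a ^ 4 - a ^ 2 * b ^ 2 + b ^ 4) : ℝ)) / (a ^ 2 - b ^ 2) := by
  have := ofReal_ne_zero_of_pos ha
  have := ofReal_ne_zero_of_pos hb
  have := sq_sub_sq_ne_zero ha hb hab
  simp only [fibreParam, causticParam, Matrix.cons_val_one]
  push_cast
  field_simp

lemma radicand_pos (ha : 0 < a) : 0 < a ^ 4 - a ^ 2 * b ^ 2 + b ^ 4 := by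
  have : 0 < a ^ 4 := by positivity
  nlinarith [sq_nonneg (a ^ 2 - 2 * b ^ 2)]

lemma sqrt_radicand_sq (ha : 0 < a) : ((√(a ^ 4 - a ^ 2 * b ^ 2 + b ^ 4) : ℝ) : ℂ) ^ 2 =
    (a : ℂ) ^ 4 - a ^ 2 * b ^ 2 + b ^ 4 := by
  rw [← Complex.ofReal_pow, Real.sq_sqrt (radicand_pos ha).le]
  push_cast
  rfl

lemma fibreParam_quadratic (ha : 0 < a) (hb : 0 < b) (hab : a ≠ b) (j : Fin 2) :
    ((a : ℂ) ^ 2 - b ^ 2) * fibreParam a b j ^ 2 =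
      2 * ((a : ℂ) ^ 2 + b ^ 2) * fibreParam a b j + 3 * ((a : ℂ) ^ 2 - b ^ 2) := by
  have hD := sq_sub_sq_ne_zero ha hb hab
  have hR := sqrt_radicand_sq (b := b) ha
  fin_cases j
  · simp only [Fin.zero_eta, fibreParam_zero ha hb hab]
    generalize ((√(a ^ 4 - a ^ 2 * b ^ 2 + b ^ 4) : ℝ) : ℂ) = R at *
    field_simp
    linear_combination 4 * hR
  · simp only [Fin.mk_one, fibreParam_one ha hb hab]
    generalize ((√(a ^ 4 - a ^ 2 * b ^ 2 + b ^ 4) : ℝ) : ℂ) = R at *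
    field_simp
    linear_combination 4 * hR

/-- Since `(1 + k²) / k = 2 (a² + b²) / (a² - b²)`, this is `fibreParam_quadratic` rewritten; the
discriminant of that quadratic is `16 (a⁴ - a² b² + b⁴)`. -/
lemma fibreParam_root (ha : 0 < a) (hb : 0 < b) (hab : a ≠ b) (j : Fin 2) :
    eccParam a b * fibreParam a b j ^ 2 =
      (1 + eccParam a b ^ 2) * fibreParam a b j + 3 * eccParam a b := by
  have := ofReal_add_ne_zero ha hb
  have h := fibreParam_quadratic ha hb hab j
  rw [eccParam]
  field_simp
  linear_combination h

lemma fibreParam_injective (ha : 0 < a) (hb : 0 < b) (hab : a ≠ b) :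
    Function.Injective (fibreParam a b) := by
  have hD := sq_sub_sq_ne_zero ha hb hab
  have hR : ((√(a ^ 4 - a ^ 2 * b ^ 2 + b ^ 4) : ℝ) : ℂ) ≠ 0 :=
    Complex.ofReal_ne_zero.2 (Real.sqrt_pos.2 (radicand_pos ha)).ne'
  have h01 : fibreParam a b 0 ≠ fibreParam a b 1 := by
    rw [fibreParam_zero ha hb hab, fibreParam_one ha hb hab]
    intro h
    generalize ((√(a ^ 4 - a ^ 2 * b ^ 2 + b ^ 4) : ℝ) : ℂ) = R at *
    field_simp at h
    exact hR (by linear_combination -h / 4)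
  intro i j hij
  fin_cases i <;> fin_cases j
  · rfl
  · exact absurd hij h01
  · exact absurd hij.symm h01
  · rfl

lemma exists_fibreParam_eq (ha : 0 < a) (hb : 0 < b) (hab : a ≠ b) {m : ℂ}
    (hm : eccParam a b * m ^ 2 = (1 + eccParam a b ^ 2) * m + 3 * eccParam a b) :
    ∃ j, m = fibreParam a b j := by
  have hk := eccParam_ne_zero ha hb hab
  have h0 := fibreParam_root ha hb hab 0
  have h1 := fibreParam_root ha hb hab 1
  have hne : fibreParam a b 0 - fibreParam a b 1 ≠ 0 :=
    sub_ne_zero.2 fun h => by simpa using fibreParam_injective ha hb hab h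
  have hsum : eccParam a b * (fibreParam a b 0 + fibreParam a b 1) = 1 + eccParam a b ^ 2 := by
    refine sub_eq_zero.1 ((mul_eq_zero.1 (?_ : (fibreParam a b 0 - fibreParam a b 1) * _ = 0)
      ).resolve_left hne)
    linear_combination h0 - h1
  have : eccParam a b * ((m - fibreParam a b 0) * (m - fibreParam a b 1)) = 0 := by
    linear_combination hm - h0 + (fibreParam a b 0 - m) * hsum
  rcases mul_eq_zero.1 ((mul_eq_zero.1 this).resolve_left hk) with h | h
  · exact ⟨0, sub_eq_zero.1 h⟩
  · exact ⟨1, sub_eq_zero.1 h⟩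

lemma causticParam_eq (ha : 0 < a) (hb : 0 < b) (hab : a ≠ b) (j : Fin 2) :
    (causticParam a b j : ℂ) = (a : ℂ) ^ 2 * b ^ 2 * fibreParam a b j / (a ^ 2 - b ^ 2) := by
  have := ofReal_ne_zero_of_pos ha
  have := ofReal_ne_zero_of_pos hb
  have := sq_sub_sq_ne_zero ha hb hab
  rw [fibreParam]
  field_simp

/-- The dual equation needs non-degenerate caustics. If `λ = -a²`, then `b² m = -(a² - b²)`, and the
quadratic for `m` reduces to `(a² - b²) a⁴ = 0`; likewise for `b`. -/
lemma sq_add_causticParam_ne_zero (ha : 0 < a) (hb : 0 < b) (hab : a ≠ b) (j : Fin 2) :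
    (a : ℂ) ^ 2 + causticParam a b j ≠ 0 ∧ (b : ℂ) ^ 2 + causticParam a b j ≠ 0 := by
  have ha' := ofReal_ne_zero_of_pos ha
  have hb' := ofReal_ne_zero_of_pos hb
  have hD := sq_sub_sq_ne_zero ha hb hab
  have hq := fibreParam_quadratic ha hb hab j
  rw [causticParam_eq ha hb hab]
  generalize fibreParam a b j = m at *
  constructor
  · intro h
    field_simp at h
    have h0 := (mul_eq_zero.1 (h.trans (mul_zero _))).resolve_left (pow_ne_zero 2 ha')
    have h' : (b : ℂ) ^ 2 * m = -(a ^ 2 - b ^ 2) := by linear_combination h0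
    have : ((a : ℂ) ^ 2 - b ^ 2) * a ^ 4 = 0 := by
      linear_combination (b : ℂ) ^ 4 * hq - ((a : ℂ) ^ 2 - b ^ 2) * (b ^ 2 * m - (a ^ 2 - b ^ 2)) * h'
        + 2 * ((a : ℂ) ^ 2 + b ^ 2) * b ^ 2 * h'
    simp [hD, ha'] at this
  · intro h
    field_simp at h
    have h0 := (mul_eq_zero.1 (h.trans (mul_zero _))).resolve_left (pow_ne_zero 2 hb')
    have h' : (a : ℂ) ^ 2 * m = -(a ^ 2 - b ^ 2) := by linear_combination h0
    have : ((a : ℂ) ^ 2 - b ^ 2) * b ^ 4 = 0 := by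
      linear_combination (a : ℂ) ^ 4 * hq - ((a : ℂ) ^ 2 - b ^ 2) * (a ^ 2 * m - (a ^ 2 - b ^ 2)) * h'
        + 2 * ((a : ℂ) ^ 2 + b ^ 2) * a ^ 2 * h'
    simp [hD, hb'] at this

/-- The dual form of `C_λ` is that of `E` plus `λ (n 0² + n 1²)`. On a chord the first summand is
`-pairDet x y ^ 2` and the second is given by `chordCovec_norm`. -/
lemma isTangentToCaustic_chord_iff (ha : 0 < a) (hb : 0 < b) (hab : a ≠ b) (j : Fin 2)
    {x y : ℂ × ℂ} (hx : x ≠ 0) (hy : y ≠ 0) :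
    IsTangentToCaustic a b j (lineOf (chordCovec a b x y)) ↔
      eccParam a b * pairDet x y ^ 2 = fibreParam a b j * ((x.1 * y.1 - eccParam a b * (x.2 * y.2)) *
        (x.2 * y.2 - eccParam a b * (x.1 * y.1))) := by
  have ha' := ofReal_ne_zero_of_pos ha
  have hb' := ofReal_ne_zero_of_pos hb
  have hab' := ofReal_add_ne_zero ha hb
  have hD := sq_sub_sq_ne_zero ha hb hab
  have hk := eccParam_ne_zero ha hb hab
  obtain ⟨h1, h2⟩ := sq_add_causticParam_ne_zero ha hb hab j
  rw [IsTangentToCaustic, isTangentToConic_lineOf_iff h1 h2 (chordCovec_ne_zero ha hb hx hy)]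
  have hN := chordCovec_norm ha hb x y
  have e1 : chordCovec a b x y 0 ^ 2 * (a : ℂ) ^ 2 + chordCovec a b x y 1 ^ 2 * (b : ℂ) ^ 2 -
      chordCovec a b x y 2 ^ 2 = -pairDet x y ^ 2 := by
    simp [chordCovec, pairDet]
    field_simp
    rw [Complex.I_sq]
    ring
  have e2 : eccParam a b * causticParam a b j * (((a : ℂ) + b) / (a * b)) ^ 2 =
      fibreParam a b j := by
    rw [causticParam_eq ha hb hab, eccParam]
    field_simp
    ring
  generalize (x.1 * y.1 - eccParam a b * (x.2 * y.2)) *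
        (x.2 * y.2 - eccParam a b * (x.1 * y.1)) = W at *
  rw [← e2]
  constructor
  · intro h
    linear_combination eccParam a b * (e1 - h + causticParam a b j * hN)
  · intro h
    refine sub_eq_zero.1 ((mul_eq_zero.1 (?_ : eccParam a b * _ = 0)).resolve_left hk)
    linear_combination -h + eccParam a b * (e1 + causticParam a b j * hN)

end

/-! ### The caustic tangent from an isotropic tangency point. -/

section

variable {k m s : ℂ}

lemma root_ne_zero (hk : k ≠ 0) (hs : s ^ 2 = k ∨ k * s ^ 2 = 1) : s ≠ 0 := by
  rintro rfl
  rcases hs with h | h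
  · exact hk (by simpa using h.symm)
  · simp at h

lemma root_pow_four_ne_one (hk1 : k ^ 2 ≠ 1) (hs : s ^ 2 = k ∨ k * s ^ 2 = 1) : s ^ 4 ≠ 1 := by
  intro h
  rcases hs with hs | hs
  · exact hk1 (by linear_combination h - (s ^ 2 + k) * hs)
  · exact hk1 (by linear_combination (k * s ^ 2 + 1) * hs - k ^ 2 * h)

lemma root_quadratic (hs : s ^ 2 = k ∨ k * s ^ 2 = 1)
    (hm : k * m ^ 2 = (1 + k ^ 2) * m + 3 * k) : s ^ 2 * m ^ 2 = (1 + s ^ 4) * m + 3 * s ^ 2 := by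
  rcases hs with rfl | hs
  · linear_combination hm
  · linear_combination s ^ 4 * hm - (s ^ 2 * m ^ 2 - 3 * s ^ 2 - (k * s ^ 2 + 1) * m) * hs

/-- The tangency condition is quadratic in `w` and has the root `w = s`, because the isotropic
tangent at `s` also touches the confocal caustic. Removing this root leaves a linear equation, and
its solution is `thirdPoint`. -/
lemma chord_thirdPoint_iff (hk : k ≠ 0) (hk1 : k ^ 2 ≠ 1)
    (hm : k * m ^ 2 = (1 + k ^ 2) * m + 3 * k) (hs : s ^ 2 = k ∨ k * s ^ 2 = 1) {w : ℂ × ℂ}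
    (hd : pairDet (s, 1) w ≠ 0) :
    ((s * w.1 - k * w.2) * (w.2 - k * (s * w.1)) ≠ 0 ∧
      k * pairDet (s, 1) w ^ 2 = m * ((s * w.1 - k * w.2) * (w.2 - k * (s * w.1)))) ↔
    pairDet (thirdPoint m s, 1) w = 0 := by
  have hs0 := root_ne_zero hk hs
  have hs4 := root_pow_four_ne_one hk1 hs
  have hq := root_quadratic hs hm
  have hthird : pairDet (thirdPoint m s, 1) w = ((m - s ^ 2) * w.2 - 2 * s * w.1) / (2 * s) := by
    simp only [pairDet, thirdPoint]
    field_simp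
  have hms : 1 + m * s ^ 2 ≠ 0 := by
    intro h
    have : 2 * (1 - s ^ 4) = 0 := by
      linear_combination s ^ 2 * hq - (m * s ^ 2 - 2 - s ^ 4) * h
    exact hs4 (by linear_combination -this / 2)
  obtain ⟨d, hde⟩ : ∃ d, d = pairDet (s, 1) w := ⟨_, rfl⟩
  have hde' : d = s * w.2 - w.1 := by rw [hde, pairDet]; ring
  rw [hthird, div_eq_zero_iff, or_iff_left (by simp [hs0]), ← hde]
  rw [← hde] at hd
  -- The two linear forms differ by the factor `(1 + m s²) / 2`, modulo the quadratic `hq`.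
  have key : s * d + m * (w.2 - s ^ 3 * w.1) = 0 ↔ (m - s ^ 2) * w.2 - 2 * s * w.1 = 0 := by
    constructor
    · intro h
      refine (mul_eq_zero.1 (?_ : (1 + m * s ^ 2) * _ = 0)).resolve_left hms
      rw [hde'] at h
      linear_combination 2 * h + w.2 * hq
    · intro h
      rw [hde']
      linear_combination (1 + m * s ^ 2) / 2 * h - w.2 / 2 * hq
  -- The isotropy form of the chord vanishes at `w = s`, since the tangent there is isotropic; hence
  -- the factor `d`.
  have hW : s ^ 2 * ((s * w.1 - k * w.2) * (w.2 - k * (s * w.1))) =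
      - k * s * d * (w.2 - s ^ 3 * w.1) := by
    rw [hde']
    rcases hs with rfl | hs
    · ring
    · linear_combination -(s * w.1 * (s * w.1 - k * w.2)) * hs
        - s ^ 2 * w.1 * (s * w.2 - w.1) * hs
  rw [← key]
  constructor
  · rintro ⟨-, h⟩
    refine (mul_eq_zero.1 (?_ : (k * s * d) * _ = 0)).resolve_left (by simp [hk, hs0, hd])
    linear_combination s ^ 2 * h + m * hW
  · intro h
    constructor
    · intro h0
      rw [h0, mul_zero] at hW
      have : w.2 - s ^ 3 * w.1 = 0 := by simpa [hk, hs0, hd] using hW.symm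
      rw [this] at h
      simp [hs0, hd] at h
    · refine sub_eq_zero.1 ((mul_eq_zero.1 (?_ : s ^ 2 * _ = 0)).resolve_left (by simp [hs0]))
      linear_combination k * s * d * h - m * hW

/-- A triple point would require `m = 3 s²`, and the quadratic for `m` then forces `s⁴ = 1`, that is
`k² = 1`. -/
lemma thirdPoint_ne (hk : k ≠ 0) (hk1 : k ^ 2 ≠ 1)
    (hm : k * m ^ 2 = (1 + k ^ 2) * m + 3 * k) (hs : s ^ 2 = k ∨ k * s ^ 2 = 1) :
    thirdPoint m s ≠ s := by
  have hs0 := root_ne_zero hk hs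
  have hs4 := root_pow_four_ne_one hk1 hs
  have hq := root_quadratic hs hm
  intro h
  rw [thirdPoint, div_eq_iff (by simp [hs0])] at h
  have h' : m = 3 * s ^ 2 := by linear_combination h
  rw [h'] at hq
  have : s ^ 2 * (s ^ 4 - 1) = 0 := by linear_combination hq / 6
  simp [hs0, sub_eq_zero, hs4] at this

end

/-! ### Triangular orbits as fibres with distinct points. -/

section

variable {a b : ℝ}

lemma pairDet_comm (x y : ℂ × ℂ) : pairDet y x = -pairDet x y := by
  rw [pairDet, pairDet]
  ring

lemma pairDet_comm_ne {x y : ℂ × ℂ} (h : pairDet x y ≠ 0) : pairDet y x ≠ 0 := by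
  rwa [pairDet_comm, neg_ne_zero]

lemma reflForm_comm (k : ℂ) (x y z : ℂ × ℂ) : reflForm k x y z = reflForm k x z y := by
  rw [reflForm, reflForm]
  ring

/-- The parameters of a triangular orbit form a fibre. -/
lemma IsTriangularOrbit.exists_inFibre (ha : 0 < a) (hb : 0 < b) (hab : a ≠ b) {M : Fin 3 → CP2}
    (h : IsTriangularOrbit a b M) :
    ∃ (x : Fin 3 → ℂ × ℂ) (hx : ∀ i, x i ≠ 0) (j : Fin 2), M = (fun i => ellipsePt ha hb (x i) (hx i)) ∧
      InFibre (fibreParam a b j) (x 0) (x 1) (x 2) := by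
  choose x hx hM using fun i => exists_ellipsePt ha hb (h.mem i)
  have d01 : pairDet (x 0) (x 1) ≠ 0 := by
    have := h.ne 0
    rwa [hM 0, zero_add, hM 1, ne_eq, ellipsePt_eq_iff] at this
  have d12 : pairDet (x 1) (x 2) ≠ 0 := by
    have := h.ne 1
    rwa [hM 1, show (1 : Fin 3) + 1 = 2 from rfl, hM 2, ne_eq, ellipsePt_eq_iff] at this
  have d20 : pairDet (x 2) (x 0) ≠ 0 := by
    have := h.ne 2
    rwa [hM 2, show (2 : Fin 3) + 1 = 0 from rfl, hM 0, ne_eq, ellipsePt_eq_iff] at this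
  have n0 := h.nonisotropic 0
  have n1 := h.nonisotropic 1
  have n2 := h.nonisotropic 2
  have r0 := h.reflection 0
  have r1 := h.reflection 1
  have r2 := h.reflection 2
  rw [show (0 : Fin 3) - 1 = 2 from rfl, show (0 : Fin 3) + 1 = 1 from rfl] at r0
  rw [show (1 : Fin 3) - 1 = 0 from rfl, show (1 : Fin 3) + 1 = 2 from rfl] at r1
  rw [show (2 : Fin 3) - 1 = 1 from rfl, show (2 : Fin 3) + 1 = 0 from rfl] at r2
  rw [hM] at n0 n1 n2
  rw [hM 0, hM 1, hM 2] at r0 r1 r2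
  rw [areSymmetric_chords_iff ha hb _ _ _ (pairDet_comm_ne d20) d01 n0] at r0
  rw [areSymmetric_chords_iff ha hb _ _ _ (pairDet_comm_ne d01) d12 n1] at r1
  rw [areSymmetric_chords_iff ha hb _ _ _ (pairDet_comm_ne d12) d20 n2] at r2
  rw [reflForm_comm] at r0 r1 r2
  obtain ⟨m, hm, hf⟩ := _root_.exists_inFibre (eccParam_ne_zero ha hb hab) (hx 0) (hx 1) (hx 2) d01
    (pairDet_comm_ne d20) d12 r0 r1 r2
  obtain ⟨j, rfl⟩ := exists_fibreParam_eq ha hb hab hm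
  exact ⟨x, hx, j, funext hM, hf⟩

/-- A fibre with distinct points is a triangular orbit. -/
lemma isTriangularOrbit_of_inFibre (ha : 0 < a) (hb : 0 < b) (hab : a ≠ b) {x : Fin 3 → ℂ × ℂ}
    (hx : ∀ i, x i ≠ 0) {j : Fin 2} (h : InFibre (fibreParam a b j) (x 0) (x 1) (x 2))
    (d01 : pairDet (x 0) (x 1) ≠ 0) (d12 : pairDet (x 1) (x 2) ≠ 0)
    (d20 : pairDet (x 2) (x 0) ≠ 0) :
    IsTriangularOrbit a b (fun i => ellipsePt ha hb (x i) (hx i)) := by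
  have hk := eccParam_ne_zero ha hb hab
  have hk1 := eccParam_sq_ne_one ha hb
  have hm := fibreParam_root ha hb hab j
  -- Non-isotropy of the tangents comes for free: at an isotropic tangency point the fibre would
  -- have a double point.
  have aux : ∀ i i' i'', InFibre (fibreParam a b j) (x i) (x i') (x i'') →
      pairDet (x i) (x i') ≠ 0 → pairDet (x i) (x i'') ≠ 0 →
      ¬ IsIsotropic (ellipseTangent a b (ellipsePt ha hb (x i) (hx i))) := by
    intro i i' i'' hf h1 h2
    rw [isIsotropic_ellipseTangent_iff,
      ← hf.pairDet_mul_eq_zero_iff hk hk1 hm (hx i) (hx i') (hx i'')]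
    exact mul_ne_zero h1 h2
  have n0 := aux 0 1 2 h d01 (pairDet_comm_ne d20)
  have n1 := aux 1 2 0 h.rotate d12 (pairDet_comm_ne d01)
  have n2 := aux 2 0 1 h.rotate.rotate d20 (pairDet_comm_ne d12)
  refine ⟨fun i => ellipsePt_mem ha hb (hx i), ?_, ?_, ?_⟩
  · intro i
    rw [ne_eq, ellipsePt_eq_iff]
    fin_cases i
    exacts [d01, d12, d20]
  · intro i
    fin_cases i
    exacts [n0, n1, n2]
  · intro i
    fin_cases i
    · refine (areSymmetric_chords_iff ha hb (hx 0) (hx 2) (hx 1) (pairDet_comm_ne d20) d01 n0).2 ?_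
      rw [reflForm_comm]
      exact h.reflForm_eq_zero hk hm
    · refine (areSymmetric_chords_iff ha hb (hx 1) (hx 0) (hx 2) (pairDet_comm_ne d01) d12 n1).2 ?_
      rw [reflForm_comm]
      exact h.rotate.reflForm_eq_zero hk hm
    · refine (areSymmetric_chords_iff ha hb (hx 2) (hx 1) (hx 0) (pairDet_comm_ne d12) d20 n2).2 ?_
      rw [reflForm_comm]
      exact h.rotate.rotate.reflForm_eq_zero hk hm

end

/-! ### Topology of the plane and limits of orbits. -/

section

/-- The Hermitian projector onto the line spanned by a vector, as a matrix. -/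
noncomputable def projectorMatrix (v : {v : Fin 3 → ℂ // v ≠ 0}) (i j : Fin 3) : ℂ :=
  v.1 i * (starRingEnd ℂ) (v.1 j) / ((∑ l, ‖v.1 l‖ ^ 2 : ℝ) : ℂ)

lemma sum_norm_sq_ne_zero {v : Fin 3 → ℂ} (hv : v ≠ 0) : ((∑ l, ‖v l‖ ^ 2 : ℝ) : ℂ) ≠ 0 := by
  rw [Complex.ofReal_ne_zero]
  intro h
  rw [Finset.sum_eq_zero_iff_of_nonneg (fun _ _ => by positivity)] at h
  exact hv (funext fun i => by simpa using h i (Finset.mem_univ i))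

lemma continuous_projectorMatrix : Continuous projectorMatrix := by
  refine continuous_pi fun i => continuous_pi fun j => ?_
  unfold projectorMatrix
  have hc : ∀ i, Continuous fun v : {v : Fin 3 → ℂ // v ≠ 0} => v.1 i :=
    fun i => (continuous_apply i).comp continuous_subtype_val
  refine Continuous.div ((hc i).mul (Complex.continuous_conj.comp (hc j)))
    (Complex.continuous_ofReal.comp (continuous_finsetSum _ fun l _ => ((hc l).norm.pow 2)))
    fun v => sum_norm_sq_ne_zero v.2

lemma projectorMatrix_smul (v w : {v : Fin 3 → ℂ // v ≠ 0}) (c : ℂ) (h : (v : Fin 3 → ℂ) = c • w.1) :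
    projectorMatrix v = projectorMatrix w := by
  have hc : c ≠ 0 := by
    rintro rfl
    exact v.2 (by simpa using h)
  ext i j
  have hw := sum_norm_sq_ne_zero w.2
  have hs : ((∑ l, ‖v.1 l‖ ^ 2 : ℝ) : ℂ) =
      c * (starRingEnd ℂ) c * ((∑ l, ‖w.1 l‖ ^ 2 : ℝ) : ℂ) := by
    rw [Complex.mul_conj, Complex.normSq_eq_norm_sq, ← Complex.ofReal_mul, Finset.mul_sum, h]
    simp only [Pi.smul_apply, smul_eq_mul, norm_mul, mul_pow]
  have hc' : (starRingEnd ℂ) c ≠ 0 := by simpa using hc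
  rw [projectorMatrix, projectorMatrix, hs, h]
  simp only [Pi.smul_apply, smul_eq_mul, map_mul]
  field_simp

/-- A line is determined by its Hermitian projector, so `v ↦ v v* / |v|²` embeds the plane
continuously in a space of matrices. Hausdorffness makes compact images closed below. -/
instance instT2SpaceCP2 : T2Space CP2 := by
  let f : CP2 → Fin 3 → Fin 3 → ℂ := Projectivization.lift projectorMatrix
    (fun v w c h => projectorMatrix_smul v w c h)
  have hf : Continuous f := continuous_coinduced_dom.2 continuous_projectorMatrix
  refine T2Space.of_injective_continuous (f := f) ?_ hf
  intro P Q hPQ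
  induction P using Projectivization.ind with
  | h v hv =>
  induction Q using Projectivization.ind with
  | h w hw =>
    have hvw : projectorMatrix ⟨v, hv⟩ = projectorMatrix ⟨w, hw⟩ := hPQ
    obtain ⟨j, hj⟩ := Function.ne_iff.1 hv
    have hj : (starRingEnd ℂ) (v j) ≠ 0 := by simpa using hj
    rw [Projectivization.mk_eq_mk_iff']
    refine ⟨((∑ l, ‖v l‖ ^ 2 : ℝ) : ℂ) * (starRingEnd ℂ) (w j) /
      (((∑ l, ‖w l‖ ^ 2 : ℝ) : ℂ) * (starRingEnd ℂ) (v j)), ?_⟩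
    ext i
    have := congr_fun (congr_fun hvw i) j
    have h1 := sum_norm_sq_ne_zero hv
    have h2 := sum_norm_sq_ne_zero hw
    simp only [projectorMatrix] at this
    simp only [Pi.smul_apply, smul_eq_mul]
    generalize ((∑ l, ‖v l‖ ^ 2 : ℝ) : ℂ) = A at *
    generalize ((∑ l, ‖w l‖ ^ 2 : ℝ) : ℂ) = B at *
    field_simp at this ⊢
    linear_combination -this

variable {a b : ℝ} (ha : 0 < a) (hb : 0 < b)

lemma continuous_ellipsePt : Continuous fun x : {x : ℂ × ℂ // x ≠ 0} => ellipsePt ha hb x.1 x.2 := by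
  have h1 : Continuous (Projectivization.mk' ℂ : {v : Fin 3 → ℂ // v ≠ 0} → CP2) :=
    continuous_coinduced_rng
  have h2 : Continuous fun x : {x : ℂ × ℂ // x ≠ 0} =>
      (⟨ellipseVec a b x.1, ellipseVec_ne_zero ha hb x.2⟩ : {v : Fin 3 → ℂ // v ≠ 0}) := by
    refine Continuous.subtype_mk (continuous_pi fun i => ?_) _
    fin_cases i
    · simp only [ellipseVec, Fin.zero_eta, Matrix.cons_val_zero]
      fun_prop
    · simp only [ellipseVec, Fin.mk_one, Matrix.cons_val_one, Matrix.cons_val_zero]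
      fun_prop
    · simp only [ellipseVec, Fin.reduceFinMk, Matrix.cons_val]
      fun_prop
  exact h1.comp h2

/-- Limits of triangular orbits are fibres, too. -/
lemma exists_inFibre_of_tendsto (hab : a ≠ b) {M : Fin 3 → CP2}
    {u : ℕ → Fin 3 → CP2} (hu : ∀ n, IsTriangularOrbit a b (u n))
    (hM : Filter.Tendsto u Filter.atTop (nhds M)) :
    ∃ (x : Fin 3 → ℂ × ℂ) (hx : ∀ i, x i ≠ 0) (j : Fin 2), M = (fun i => ellipsePt ha hb (x i) (hx i)) ∧
      InFibre (fibreParam a b j) (x 0) (x 1) (x 2) := by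
  -- With parameters normalized to the unit sphere, the fibres for both values of `m` form a compact
  -- set. Its image is closed and contains every orbit, hence also the limit.
  let Z : Set (Fin 3 → Metric.sphere (0 : ℂ × ℂ) 1) :=
    ⋃ j : Fin 2, {x | InFibre (fibreParam a b j) (x 0) (x 1) (x 2)}
  have hZ : IsClosed Z := by
    refine isClosed_iUnion_of_finite fun j => ?_
    simp only [InFibre, Set.ofPred_and]
    exact (isClosed_eq (by fun_prop) (by fun_prop)).inter (isClosed_eq (by fun_prop) (by fun_prop))
  let Φ : (Fin 3 → Metric.sphere (0 : ℂ × ℂ) 1) → Fin 3 → CP2 :=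
    fun x i => ellipsePt ha hb (x i) (ne_zero_of_mem_unit_sphere (x i))
  have hΦ : Continuous Φ := by
    refine continuous_pi fun i => ?_
    exact (continuous_ellipsePt ha hb).comp (f := fun x : Fin 3 → Metric.sphere (0 : ℂ × ℂ) 1 =>
      (⟨x i, ne_zero_of_mem_unit_sphere (x i)⟩ : {x : ℂ × ℂ // x ≠ 0})) (by fun_prop)
  have hcl : IsClosed (Φ '' Z) := (hZ.isCompact.image hΦ).isClosed
  have hmem : M ∈ Φ '' Z := by
    refine hcl.mem_of_tendsto hM (Filter.Eventually.of_forall fun n => ?_)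
    obtain ⟨x, hx, j, hxu, hf⟩ := (hu n).exists_inFibre ha hb hab
    have hn : ∀ i, (‖x i‖ : ℂ)⁻¹ ≠ 0 := fun i => by simpa using hx i
    refine ⟨fun i => ⟨(‖x i‖ : ℂ)⁻¹ • x i, ?_⟩, Set.mem_iUnion.2 ⟨j, hf.smul _ _ _⟩, ?_⟩
    · rw [mem_sphere_zero_iff_norm, norm_smul, norm_inv, Complex.norm_real, norm_norm,
        inv_mul_cancel₀ (norm_ne_zero_iff.2 (hx i))]
    · rw [hxu]
      funext i
      refine ((ellipsePt_eq_iff ha hb (hx i) _).2 ?_).symm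
      exact (pairDet_eq_zero_iff (hx i) (smul_ne_zero (hn i) (hx i))).2 ⟨_, hn i, rfl⟩
  obtain ⟨x, hx, rfl⟩ := hmem
  obtain ⟨j, hj⟩ := Set.mem_iUnion.1 hx
  exact ⟨fun i => x i, fun i => ne_zero_of_mem_unit_sphere (x i), j, rfl, hj⟩

end

/-! ### Approximation of critical fibres by fibres with distinct points. -/

section

variable {k m s : ℂ}

/-- The two remaining points of the fibre of `z` are the roots of a quadratic polynomial. -/
lemma inFibre_of_quadratic {z p q w : ℂ} (c1 : m * z ^ 2 + 1 ≠ 0)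
    (c2 : (m ^ 2 - 1) ^ 2 * z ^ 2 - 4 * (z ^ 2 + m) * (m * z ^ 2 + 1) ≠ 0)
    (c3 : m * z ^ 4 + (3 - m ^ 2) * z ^ 2 + m ≠ 0)
    (hq : 2 * (m * z ^ 2 + 1) * q = (m ^ 2 - 1) * z) (hp : (m * z ^ 2 + 1) * p = z ^ 2 + m)
    (hw : w ^ 2 = q ^ 2 - p) :
    InFibre m (q + w, 1) (q - w, 1) (z, 1) ∧ pairDet (q + w, 1) (q - w, 1) ≠ 0 ∧
      pairDet (q - w, 1) (z, 1) ≠ 0 ∧ pairDet (z, 1) (q + w, 1) ≠ 0 := by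
  simp only [InFibre, pairDet, mul_one]
  -- The value at `z` of the quadratic with roots `q ± w`; by `c3` it is nonzero, so neither root
  -- equals `z`.
  have hprod : (m * z ^ 2 + 1) * ((z - (q + w)) * (z - (q - w))) =
      m * z ^ 4 + (3 - m ^ 2) * z ^ 2 + m := by
    linear_combination -z * hq + hp - (m * z ^ 2 + 1) * hw
  refine ⟨⟨?_, ?_⟩, ?_, ?_, ?_⟩
  · refine sub_eq_zero.1 ((mul_eq_zero.1 (?_ : (m * z ^ 2 + 1) * _ = 0)).resolve_left c1)
    linear_combination hq - m * z * hp + m * z * (m * z ^ 2 + 1) * hw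
  · refine sub_eq_zero.1 ((mul_eq_zero.1 (?_ : (m * z ^ 2 + 1) * _ = 0)).resolve_left c1)
    linear_combination hp + z * hq - (m * z ^ 2 + 1) * hw
  · intro h
    have hw0 : w = 0 := by linear_combination h / 2
    rw [hw0] at hw
    -- The expression in `c2` is the discriminant `4 (m z² + 1)² (q² - p)`.
    apply c2
    linear_combination -4 * (m * z ^ 2 + 1) ^ 2 * hw -
      (2 * (m * z ^ 2 + 1) * q + (m ^ 2 - 1) * z) * hq + 4 * (m * z ^ 2 + 1) * hp
  · intro h
    apply c3
    rw [← hprod]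
    linear_combination -(m * z ^ 2 + 1) * (z - (q + w)) * h
  · intro h
    apply c3
    rw [← hprod]
    linear_combination (m * z ^ 2 + 1) * (z - (q - w)) * h

open Polynomial in
/-- Fibres with distinct points accumulate at a fibre with a double point. -/
lemma exists_fibres_tendsto (hk : k ≠ 0) (hk1 : k ^ 2 ≠ 1)
    (hm : k * m ^ 2 = (1 + k ^ 2) * m + 3 * k) (hs : s ^ 2 = k ∨ k * s ^ 2 = 1) :
    ∃ x y z : ℕ → ℂ, Filter.Tendsto x Filter.atTop (nhds s) ∧
      Filter.Tendsto y Filter.atTop (nhds s) ∧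
      Filter.Tendsto z Filter.atTop (nhds (thirdPoint m s)) ∧
      ∀ n, InFibre m (x n, 1) (y n, 1) (z n, 1) ∧ pairDet (x n, 1) (y n, 1) ≠ 0 ∧
        pairDet (y n, 1) (z n, 1) ≠ 0 ∧ pairDet (z n, 1) (x n, 1) ≠ 0 := by
  have hm0 := param_ne_zero hk hm
  have hfib : InFibre m (s, 1) (s, 1) (thirdPoint m s, 1) :=
    (inFibre_double_iff hk hm hs _).2 (by rw [pairDet]; ring)
  generalize thirdPoint m s = t at *
  obtain ⟨r, hr, e1, e2, e3⟩ := hfib.rotate.rotate.exists_factor (param_sq_ne_one hk1 hm)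
    (by simp) (by simp) (by simp)
  simp only [mul_one, one_pow] at e1 e2 e3
  have ht : m * t ^ 2 + 1 ≠ 0 := fun h => by simp [h] at e3
  have hr' : r = 1 / (m * t ^ 2 + 1) := by
    field_simp
    exact e3.symm
  -- The half-sum `q` and the product `p` of the other two points in the fibre of `z`; at `z = t`
  -- both of these points are `s`.
  let q : ℂ → ℂ := fun z => (m ^ 2 - 1) * z / (2 * (m * z ^ 2 + 1))
  let p : ℂ → ℂ := fun z => (z ^ 2 + m) / (m * z ^ 2 + 1)
  have hqt : q t = s := by
    simp only [q]
    rw [hr'] at e2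
    field_simp at e2 ⊢
    linear_combination -e2
  have hpt : p t = s ^ 2 := by
    simp only [p]
    rw [hr'] at e1
    field_simp at e1 ⊢
    linear_combination -e1
  have hqc : ContinuousAt q t := by
    refine ContinuousAt.div (by fun_prop) (by fun_prop) (mul_ne_zero two_ne_zero ht)
  have hpc : ContinuousAt p t := ContinuousAt.div (by fun_prop) (by fun_prop) ht
  -- The zeros of `Q` are the finitely many `z` for which `inFibre_of_quadratic` does not apply; its
  -- value at `0` is `-4 m²`.
  let Q : ℂ[X] := (C m * X ^ 2 + 1) *
    (C ((m ^ 2 - 1) ^ 2) * X ^ 2 - 4 * (X ^ 2 + C m) * (C m * X ^ 2 + 1)) *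
    (C m * X ^ 4 + C (3 - m ^ 2) * X ^ 2 + C m)
  have hQ : Q ≠ 0 := by
    intro h
    have := congr_arg (eval 0) h
    simp [Q, hm0] at this
  have hev : ∀ᶠ z in nhdsWithin t {t}ᶜ, Q.eval z ≠ 0 :=
    nhdsNE_le_cofinite t (Polynomial.finite_setOfPred_isRoot hQ).compl_mem_cofinite
  obtain ⟨z₀, hz₀⟩ := Filter.exists_seq_tendsto (nhdsWithin t {t}ᶜ)
  obtain ⟨N, hN⟩ := Filter.eventually_atTop.1 (hz₀.eventually hev)
  obtain ⟨z, hz, hzQ⟩ : ∃ z : ℕ → ℂ, Filter.Tendsto z Filter.atTop (nhds t) ∧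
      ∀ n, Q.eval (z n) ≠ 0 :=
    ⟨fun n => z₀ (n + N), (Filter.tendsto_add_atTop_iff_nat N).2 (hz₀.mono_right nhdsWithin_le_nhds),
      fun n => hN _ (by omega)⟩
  -- An arbitrary, possibly discontinuous square root suffices: only its modulus matters, and the
  -- quarter-discriminant `q² - p` tends to `0`.
  choose root hroot using fun w : ℂ => IsAlgClosed.exists_pow_nat_eq w two_pos
  have hlim : Filter.Tendsto (fun n => root (q (z n) ^ 2 - p (z n))) Filter.atTop (nhds 0) := by
    have h0 : Filter.Tendsto (fun n => q (z n) ^ 2 - p (z n)) Filter.atTop (nhds 0) := by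
      have := ((hqc.pow 2).sub hpc).tendsto.comp hz
      simpa [hqt, hpt, Function.comp_def] using this
    rw [tendsto_zero_iff_norm_tendsto_zero] at h0 ⊢
    have h1 := (Real.continuous_sqrt.tendsto 0).comp h0
    rw [Real.sqrt_zero] at h1
    refine h1.congr fun n => ?_
    rw [Function.comp_apply]
    conv_lhs => rw [← hroot (q (z n) ^ 2 - p (z n)), norm_pow, Real.sqrt_sq (norm_nonneg _)]
  have hql : Filter.Tendsto (fun n => q (z n)) Filter.atTop (nhds s) := by
    have := hqc.tendsto.comp hz
    rwa [hqt] at this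
  refine ⟨fun n => q (z n) + root (q (z n) ^ 2 - p (z n)),
    fun n => q (z n) - root (q (z n) ^ 2 - p (z n)), z, by simpa using hql.add hlim,
    by simpa using hql.sub hlim, hz, fun n => ?_⟩
  have hQn := hzQ n
  have hw := hroot (q (z n) ^ 2 - p (z n))
  simp only [Q, eval_mul, eval_add, eval_sub, eval_C, eval_X, eval_pow, eval_one, eval_ofNat,
    ne_eq, mul_eq_zero, not_or] at hQn
  obtain ⟨⟨c1, c2⟩, c3⟩ := hQn
  have hq : 2 * (m * z n ^ 2 + 1) * q (z n) = (m ^ 2 - 1) * z n := by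
    simp only [q]
    field_simp
  have hp : (m * z n ^ 2 + 1) * p (z n) = z n ^ 2 + m := by
    simp only [p]
    field_simp
  exact inFibre_of_quadratic c1 c2 c3 hq hp hw

end

/-! ### Classification and count of the degenerate orbits. -/

section

variable {a b : ℝ} (ha : 0 < a) (hb : 0 < b)

/-- The point of the ellipse with affine parameter `s`. -/
noncomputable def affinePt (s : ℂ) : CP2 := ellipsePt ha hb (s, 1) (by simp)

lemma affinePt_injective : Function.Injective (affinePt ha hb) := by
  intro s t h
  rw [affinePt, affinePt, ellipsePt_eq_iff, pairDet] at h
  linear_combination h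

lemma continuous_affinePt : Continuous (affinePt ha hb) :=
  (continuous_ellipsePt ha hb).comp
    (f := fun s : ℂ => (⟨(s, 1), by simp⟩ : {x : ℂ × ℂ // x ≠ 0})) (by fun_prop)

lemma exists_affinePt (hk : eccParam a b ≠ 0) {x : ℂ × ℂ} (hx : x ≠ 0)
    (h : (x.1 ^ 2 - eccParam a b * x.2 ^ 2) * (x.2 ^ 2 - eccParam a b * x.1 ^ 2) = 0) :
    ∃ s, (s ^ 2 = eccParam a b ∨ eccParam a b * s ^ 2 = 1) ∧ x = x.2 • ((s, 1) : ℂ × ℂ) ∧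
      x.2 ≠ 0 := by
  have hx2 : x.2 ≠ 0 := by
    intro h2
    rw [prod_ne_zero_iff] at hx
    simp [h2, hk] at h hx
    exact hx h
  refine ⟨x.1 / x.2, ?_, ?_, hx2⟩
  · rcases mul_eq_zero.1 h with h | h
    · left
      field_simp
      linear_combination h
    · right
      field_simp
      linear_combination -h
  · ext
    · simp
      field_simp
    · simp

lemma isIsotropicTangencyPoint_iff (hab : a ≠ b) (α : CP2) : IsIsotropicTangencyPoint a b α ↔
    ∃ s, (s ^ 2 = eccParam a b ∨ eccParam a b * s ^ 2 = 1) ∧ α = affinePt ha hb s := by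
  have hk := eccParam_ne_zero ha hb hab
  constructor
  · rintro ⟨hα, hi⟩
    obtain ⟨x, hx, rfl⟩ := exists_ellipsePt ha hb hα
    rw [isIsotropic_ellipseTangent_iff] at hi
    obtain ⟨s, hs, hxs, hx2⟩ := exists_affinePt hk hx hi
    refine ⟨s, hs, ?_⟩
    rw [affinePt, ellipsePt_eq_iff, hxs, pairDet]
    simp
    ring
  · rintro ⟨s, hs, rfl⟩
    refine ⟨ellipsePt_mem ha hb _, ?_⟩
    rw [affinePt, isIsotropic_ellipseTangent_iff]
    rcases hs with h | h <;> simp [h]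

/-- This identifies the geometric description of `β` by a caustic with the third point of a critical
fibre, and contains the uniqueness of `β`. -/
lemma isDegeneratePair_affinePt_iff (hab : a ≠ b) (j : Fin 2) {s : ℂ}
    (hs : s ^ 2 = eccParam a b ∨ eccParam a b * s ^ 2 = 1) (β : CP2) :
    IsDegeneratePair a b j (affinePt ha hb s) β ↔
      β = affinePt ha hb (thirdPoint (fibreParam a b j) s) := by
  have hk := eccParam_ne_zero ha hb hab
  have hk1 := eccParam_sq_ne_one ha hb
  have hm := fibreParam_root ha hb hab j
  have hs1 : ((s, 1) : ℂ × ℂ) ≠ 0 := by simp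
  constructor
  · intro h
    obtain ⟨y, hy, rfl⟩ := exists_ellipsePt ha hb h.mem
    have hd : pairDet (s, 1) y ≠ 0 := by
      have := h.ne
      rwa [affinePt, ne_eq, ellipsePt_eq_iff] at this
    have h1 := h.nonisotropic
    have h2 := h.tangent
    rw [affinePt, lineThrough_ellipsePt ha hb hs1 hy hd] at h1 h2
    rw [isIsotropic_chord_iff ha hb] at h1
    rw [isTangentToCaustic_chord_iff ha hb hab j hs1 hy] at h2
    simp only [one_mul] at h1 h2
    rw [eq_comm, affinePt, ellipsePt_eq_iff]
    exact (chord_thirdPoint_iff hk hk1 hm hs hd).1 ⟨h1, h2⟩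
  · rintro rfl
    have hy : ((thirdPoint (fibreParam a b j) s, 1) : ℂ × ℂ) ≠ 0 := by simp
    have hne : s ≠ thirdPoint (fibreParam a b j) s := (thirdPoint_ne hk hk1 hm hs).symm
    have hd : pairDet (s, 1) (thirdPoint (fibreParam a b j) s, 1) ≠ 0 := by
      simpa [pairDet, sub_eq_zero] using hne
    have h := (chord_thirdPoint_iff hk hk1 hm hs hd).2 (by rw [pairDet]; ring)
    refine ⟨(isIsotropicTangencyPoint_iff ha hb hab _).2 ⟨s, hs, rfl⟩, ellipsePt_mem ha hb _,
      fun h => hne (affinePt_injective ha hb h), ?_, ?_⟩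
    · rw [affinePt, affinePt, lineThrough_ellipsePt ha hb hs1 hy hd, isIsotropic_chord_iff ha hb]
      simpa only [one_mul] using h.1
    · rw [affinePt, affinePt, lineThrough_ellipsePt ha hb hs1 hy hd,
        isTangentToCaustic_chord_iff ha hb hab j hs1 hy]
      simpa only [one_mul] using h.2

/-- A fibre with a double point. -/
lemma InFibre.exists_degenerate (hab : a ≠ b) {j : Fin 2} {x y z : ℂ × ℂ} (hx : x ≠ 0)
    (hy : y ≠ 0) (hz : z ≠ 0) (h : InFibre (fibreParam a b j) x y z) (hxy : pairDet x y = 0) :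
    ∃ s, (s ^ 2 = eccParam a b ∨ eccParam a b * s ^ 2 = 1) ∧
      ellipsePt ha hb x hx = affinePt ha hb s ∧ ellipsePt ha hb y hy = affinePt ha hb s ∧
      ellipsePt ha hb z hz = affinePt ha hb (thirdPoint (fibreParam a b j) s) := by
  have hk := eccParam_ne_zero ha hb hab
  have hk1 := eccParam_sq_ne_one ha hb
  have hm := fibreParam_root ha hb hab j
  obtain ⟨s, hs, hxs, hx2⟩ := exists_affinePt hk hx
    ((h.pairDet_mul_eq_zero_iff hk hk1 hm hx hy hz).1 (by rw [hxy, zero_mul]))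
  obtain ⟨c, hc, hyx⟩ := (pairDet_eq_zero_iff hx hy).1 hxy
  have ex : ellipsePt ha hb x hx = affinePt ha hb s := by
    rw [affinePt, ellipsePt_eq_iff, hxs, pairDet]
    simp
    ring
  refine ⟨s, hs, ex, ?_, ?_⟩
  · rw [← ex, eq_comm, ellipsePt_eq_iff, hxy]
  · have h' := h.smul x.2⁻¹ (c * x.2)⁻¹ 1
    have e1 : x.2⁻¹ • x = (s, 1) := by
      conv_lhs => rw [hxs]
      rw [smul_smul]
      simp [hx2]
    have e2 : (c * x.2)⁻¹ • y = (s, 1) := by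
      rw [hyx, smul_smul, ← e1]
      congr 1
      field_simp
    rw [e1, e2, one_smul, inFibre_double_iff hk hm hs] at h'
    rw [eq_comm, affinePt, ellipsePt_eq_iff]
    exact h'

lemma isDegenerateTriangularOrbit_of_tendsto {M : Fin 3 → CP2} {i i' : Fin 3} (hi : i ≠ i')
    (hM : M i = M i') {u : ℕ → Fin 3 → CP2} (hu : ∀ n, IsTriangularOrbit a b (u n))
    (hlim : Filter.Tendsto u Filter.atTop (nhds M)) (hmem : ∀ l, M l ∈ ellipse a b) :
    IsDegenerateTriangularOrbit a b M where
  mem := hmem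
  isLimit := ⟨u, hu, hlim⟩
  not_orbit h := by
    have h0 := h.ne 0
    have h1 := h.ne 1
    have h2 := h.ne 2
    simp only [zero_add, show (1 : Fin 3) + 1 = 2 from rfl, show (2 : Fin 3) + 1 = 0 from rfl]
      at h0 h1 h2
    fin_cases i <;> fin_cases i' <;> simp_all

/-- The three degenerate orbits with double vertex `affinePt s`. -/
lemma isDegenerateTriangularOrbit_affinePt (hab : a ≠ b) (j : Fin 2) {s : ℂ}
    (hs : s ^ 2 = eccParam a b ∨ eccParam a b * s ^ 2 = 1) {M : Fin 3 → CP2} {α β : CP2}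
    (hα : α = affinePt ha hb s) (hβ : β = affinePt ha hb (thirdPoint (fibreParam a b j) s))
    (hM : M = ![α, α, β] ∨ M = ![α, β, α] ∨ M = ![β, α, α]) :
    IsDegenerateTriangularOrbit a b M := by
  obtain ⟨x, y, z, hx, hy, hz, h⟩ := exists_fibres_tendsto (eccParam_ne_zero ha hb hab)
    (eccParam_sq_ne_one ha hb) (fibreParam_root ha hb hab j) hs
  have hx' := ((continuous_affinePt ha hb).tendsto _).comp hx
  have hy' := ((continuous_affinePt ha hb).tendsto _).comp hy
  have hz' := ((continuous_affinePt ha hb).tendsto _).comp hz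
  rw [← hα] at hx' hy'
  rw [← hβ] at hz'
  have hα' : α ∈ ellipse a b := hα ▸ ellipsePt_mem ha hb _
  have hβ' : β ∈ ellipse a b := hβ ▸ ellipsePt_mem ha hb _
  have key : ∀ p q r : ℂ, InFibre (fibreParam a b j) (p, 1) (q, 1) (r, 1) →
      pairDet (p, 1) (q, 1) ≠ 0 → pairDet (q, 1) (r, 1) ≠ 0 → pairDet (r, 1) (p, 1) ≠ 0 →
      IsTriangularOrbit a b ![affinePt ha hb p, affinePt ha hb q, affinePt ha hb r] := by
    intro p q r hf h1 h2 h3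
    have := isTriangularOrbit_of_inFibre ha hb hab (x := ![(p, 1), (q, 1), (r, 1)])
      (fun i => by fin_cases i <;> simp) hf h1 h2 h3
    convert this using 1
    ext i
    fin_cases i <;> rfl
  have hl : ∀ {u v w : ℕ → CP2} {A B C : CP2}, Filter.Tendsto u Filter.atTop (nhds A) →
      Filter.Tendsto v Filter.atTop (nhds B) → Filter.Tendsto w Filter.atTop (nhds C) →
      Filter.Tendsto (fun n => ![u n, v n, w n]) Filter.atTop (nhds ![A, B, C]) := by
    intro u v w A B C h1 h2 h3
    rw [tendsto_pi_nhds]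
    intro i
    fin_cases i
    exacts [h1, h2, h3]
  have hmem : ∀ {A B C : CP2}, A ∈ ellipse a b → B ∈ ellipse a b → C ∈ ellipse a b →
      ∀ l, (![A, B, C] : Fin 3 → CP2) l ∈ ellipse a b := by
    intro A B C h1 h2 h3 l
    fin_cases l
    exacts [h1, h2, h3]
  rcases hM with rfl | rfl | rfl
  · exact isDegenerateTriangularOrbit_of_tendsto (i := 0) (i' := 1) (by decide) rfl
      (fun n => key _ _ _ (h n).1 (h n).2.1 (h n).2.2.1 (h n).2.2.2) (hl hx' hy' hz')
      (hmem hα' hα' hβ')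
  · exact isDegenerateTriangularOrbit_of_tendsto (i := 0) (i' := 2) (by decide) rfl
      (fun n => key _ _ _ (h n).1.rotate.swap₁₂.rotate.rotate (pairDet_comm_ne (h n).2.2.2)
        (pairDet_comm_ne (h n).2.2.1) (pairDet_comm_ne (h n).2.1)) (hl hx' hz' hy')
      (hmem hα' hβ' hα')
  · exact isDegenerateTriangularOrbit_of_tendsto (i := 1) (i' := 2) (by decide) rfl
      (fun n => key _ _ _ (h n).1.rotate.rotate (h n).2.2.2 (h n).2.1 (h n).2.2.1) (hl hz' hx' hy')
      (hmem hβ' hα' hα')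

lemma isDegenerateTriangularOrbit_iff (ha : 0 < a) (hb : 0 < b) (hab : a ≠ b) (M : Fin 3 → CP2) :
    IsDegenerateTriangularOrbit a b M ↔
      ∃ (j : Fin 2) (α β : CP2), IsDegeneratePair a b j α β ∧
        (M = ![α, α, β] ∨ M = ![α, β, α] ∨ M = ![β, α, α]) := by
  constructor
  · intro hM
    obtain ⟨u, hu, hlim⟩ := hM.isLimit
    obtain ⟨x, hx, j, hMx, hf⟩ := exists_inFibre_of_tendsto ha hb hab hu hlim
    have hM0 : M 0 = ellipsePt ha hb (x 0) (hx 0) := congr_fun hMx 0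
    have hM1 : M 1 = ellipsePt ha hb (x 1) (hx 1) := congr_fun hMx 1
    have hM2 : M 2 = ellipsePt ha hb (x 2) (hx 2) := congr_fun hMx 2
    have hMe : M = ![M 0, M 1, M 2] := by
      ext i
      fin_cases i <;> rfl
    by_cases d01 : pairDet (x 0) (x 1) = 0
    · obtain ⟨s, hs, e1, e2, e3⟩ := hf.exists_degenerate ha hb hab (hx 0) (hx 1) (hx 2) d01
      refine ⟨j, _, _, (isDegeneratePair_affinePt_iff ha hb hab j hs _).2 rfl, Or.inl ?_⟩
      rw [hMe, hM0, hM1, hM2, e1, e2, e3]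
    by_cases d12 : pairDet (x 1) (x 2) = 0
    · obtain ⟨s, hs, e1, e2, e3⟩ := hf.rotate.exists_degenerate ha hb hab (hx 1) (hx 2) (hx 0) d12
      refine ⟨j, _, _, (isDegeneratePair_affinePt_iff ha hb hab j hs _).2 rfl, Or.inr (Or.inr ?_)⟩
      rw [hMe, hM0, hM1, hM2, e1, e2, e3]
    by_cases d20 : pairDet (x 2) (x 0) = 0
    · obtain ⟨s, hs, e1, e2, e3⟩ :=
        hf.rotate.rotate.exists_degenerate ha hb hab (hx 2) (hx 0) (hx 1) d20
      refine ⟨j, _, _, (isDegeneratePair_affinePt_iff ha hb hab j hs _).2 rfl, Or.inr (Or.inl ?_)⟩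
      rw [hMe, hM0, hM1, hM2, e1, e2, e3]
    -- With no coincidence among the parameters, the limiting fibre is itself an orbit.
    refine absurd ?_ hM.not_orbit
    rw [hMx]
    exact isTriangularOrbit_of_inFibre ha hb hab hx hf d01 d12 d20
  · rintro ⟨j, α, β, hp, hM⟩
    obtain ⟨s, hs, hα⟩ := (isIsotropicTangencyPoint_iff ha hb hab α).1 hp.tangency
    rw [hα, isDegeneratePair_affinePt_iff ha hb hab j hs] at hp
    exact isDegenerateTriangularOrbit_affinePt ha hb hab j hs hα hp hM

lemma thirdPoint_param_injective {m m' s : ℂ} (hs : s ≠ 0) (h : thirdPoint m s = thirdPoint m' s) :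
    m = m' := by
  rw [thirdPoint, thirdPoint] at h
  field_simp at h
  linear_combination h

/-- On the left `α` occurs twice, whereas on the right anything other than `α'` occurs at most once.
-/
lemma multiset_pair_eq {ι : Type*} {α β α' β' : ι} (h : α ≠ β)
    (he : ({α, α, β} : Multiset ι) = {α', α', β'}) : α = α' ∧ β = β' := by
  classical
  have h1 := congr_arg (Multiset.count α) he
  have h2 : α = α' := by
    by_contra hne
    simp only [Multiset.insert_eq_cons, Multiset.count_cons, Multiset.count_singleton, h, hne,
      if_true, if_false] at h1
    split_ifs at h1 <;> omega
  subst h2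
  simpa using he

/-- The parameters of the isotropic tangency points. -/
noncomputable def isotropicRoots (r : ℂ) : Fin 4 → ℂ := ![r, -r, r⁻¹, -r⁻¹]

lemma isotropicRoots_injective {r k : ℂ} (hr : r ^ 2 = k) (hk : k ≠ 0) (hk1 : k ^ 2 ≠ 1) :
    Function.Injective (isotropicRoots r) := by
  subst hr
  have h0 : r ≠ 0 := by simpa using hk
  have h1 : r ≠ -r := fun h => h0 (by linear_combination h / 2)
  have h2 : r ≠ r⁻¹ := fun h => hk1 (by
    field_simp at h
    rw [h, one_pow])
  have h3 : r ≠ -r⁻¹ := fun h => hk1 (by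
    field_simp at h
    rw [h]
    norm_num)
  have h4 : -r ≠ r⁻¹ := fun h => h3 (by rw [← h, neg_neg])
  have h5 : -r ≠ -r⁻¹ := fun h => h2 (neg_injective h)
  have h6 : r⁻¹ ≠ -r⁻¹ := fun h => inv_ne_zero h0 (by linear_combination h / 2)
  intro i j hij
  fin_cases i <;> fin_cases j <;> simp_all [isotropicRoots]

lemma exists_isotropicRoots_iff {r k : ℂ} (hr : r ^ 2 = k) (hk : k ≠ 0) (s : ℂ) :
    (s ^ 2 = k ∨ k * s ^ 2 = 1) ↔ ∃ i, s = isotropicRoots r i := by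
  subst hr
  have h0 : r ≠ 0 := by simpa using hk
  constructor
  · rintro (h | h)
    · rcases sq_eq_sq_iff_eq_or_eq_neg.1 h with h | h
      exacts [⟨0, h⟩, ⟨1, h⟩]
    · have h' : s ^ 2 = r⁻¹ ^ 2 := by
        field_simp
        linear_combination h
      rcases sq_eq_sq_iff_eq_or_eq_neg.1 h' with h | h
      exacts [⟨2, h⟩, ⟨3, h⟩]
  · rintro ⟨i, rfl⟩
    fin_cases i <;> simp [isotropicRoots, h0]

lemma ncard_degenerate (ha : 0 < a) (hb : 0 < b) (hab : a ≠ b) :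
    {s : Multiset CP2 | ∃ M : Fin 3 → CP2, IsDegenerateTriangularOrbit a b M ∧
      s = {M 0, M 1, M 2}}.ncard = 8 := by
  have hk := eccParam_ne_zero ha hb hab
  have hk1 := eccParam_sq_ne_one ha hb
  obtain ⟨r, hr⟩ := IsAlgClosed.exists_pow_nat_eq (eccParam a b) two_pos
  -- One unordered triple for each of the four isotropic tangency parameters and each of the two
  -- caustics.
  let f : Fin 4 × Fin 2 → Multiset CP2 := fun p =>
    {affinePt ha hb (isotropicRoots r p.1), affinePt ha hb (isotropicRoots r p.1),
      affinePt ha hb (thirdPoint (fibreParam a b p.2) (isotropicRoots r p.1))}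
  have hf : Function.Injective f := by
    rintro ⟨i, j⟩ ⟨i', j'⟩ h
    have hs := (exists_isotropicRoots_iff hr hk _).2 ⟨i, rfl⟩
    obtain ⟨h1, h2⟩ := multiset_pair_eq (fun h => thirdPoint_ne hk hk1
      (fibreParam_root ha hb hab j) hs (affinePt_injective ha hb h).symm) h
    have h1 := isotropicRoots_injective hr hk hk1 (affinePt_injective ha hb h1)
    simp only at h1
    subst h1
    have h2 := fibreParam_injective ha hb hab
      (thirdPoint_param_injective (root_ne_zero hk hs) (affinePt_injective ha hb h2))
    simp only at h2
    rw [h2]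
  have hrange : {s : Multiset CP2 | ∃ M : Fin 3 → CP2, IsDegenerateTriangularOrbit a b M ∧
      s = {M 0, M 1, M 2}} = Set.range f := by
    ext t
    simp only [Set.mem_ofPred_eq, isDegenerateTriangularOrbit_iff ha hb hab, Set.mem_range]
    constructor
    · rintro ⟨M, ⟨j, α, β, hp, hM⟩, rfl⟩
      obtain ⟨s, hs, rfl⟩ := (isIsotropicTangencyPoint_iff ha hb hab α).1 hp.tangency
      rw [isDegeneratePair_affinePt_iff ha hb hab j hs] at hp
      obtain ⟨i, rfl⟩ := (exists_isotropicRoots_iff hr hk s).1 hs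
      subst hp
      refine ⟨(i, j), ?_⟩
      rcases hM with rfl | rfl | rfl
      · rfl
      · exact congr_arg (Multiset.cons _) (Multiset.cons_swap _ _ 0)
      · exact (congr_arg (Multiset.cons _) (Multiset.cons_swap _ _ 0)).trans
          (Multiset.cons_swap _ _ _)
    · rintro ⟨⟨i, j⟩, rfl⟩
      have hs := (exists_isotropicRoots_iff hr hk _).2 ⟨i, rfl⟩
      exact ⟨_, ⟨j, _, _, (isDegeneratePair_affinePt_iff ha hb hab j hs _).2 rfl, Or.inl rfl⟩, rfl⟩
  rw [hrange, ← Set.image_univ, Set.ncard_image_of_injective _ hf, Set.ncard_univ,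
    Nat.card_eq_fintype_card]
  rfl

end

theorem corollary1p5 (a b : ℝ) (ha : 0 < a) (hb : 0 < b) (hab : a ≠ b) :
    -- the degenerate orbits are the triples with vertices `α, α, β`, in any order
    (∀ M : Fin 3 → CP2, IsDegenerateTriangularOrbit a b M ↔
      ∃ (j : Fin 2) (α β : CP2), IsDegeneratePair a b j α β ∧
        (M = ![α, α, β] ∨ M = ![α, β, α] ∨ M = ![β, α, α])) ∧
    -- `β` is determined by the isotropic tangency point and the caustic
    (∀ α : CP2, IsIsotropicTangencyPoint a b α →
      ∀ j : Fin 2, ∃! β : CP2, IsDegeneratePair a b j α β) ∧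
    -- up to the order of the vertices there are exactly `8` of them
    {s : Multiset CP2 | ∃ M : Fin 3 → CP2, IsDegenerateTriangularOrbit a b M ∧
      s = {M 0, M 1, M 2}}.ncard = 8 := by
  refine ⟨isDegenerateTriangularOrbit_iff ha hb hab, fun α hα j => ?_, ncard_degenerate ha hb hab⟩
  obtain ⟨s, hs, rfl⟩ := (isIsotropicTangencyPoint_iff ha hb hab α).1 hα
  exact ⟨_, (isDegeneratePair_affinePt_iff ha hb hab j hs _).2 rfl,
    fun β hβ => (isDegeneratePair_affinePt_iff ha hb hab j hs β).1 hβ⟩
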